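/- **Setting.** Let $N\ge 1$, $d_1,\dots,d_N\ge 1$, $\eta>0$, $\mathcal H=\prod_{i=1}^N\{h_i\in\mathbb R^{d_i}:h_i\ge 0,\ \mathbf 1^\top h_i=1\}$, and let $\mathcal C\subseteq\mathbb R^m$ be closed and convex with normal cone $N_{\mathcal C}(y)=\{p:\langle p,y'-y\rangle\le 0\ \forall y'\in\mathcal C\}$. For $g^\eta(h,y)=g(h,y)+\eta\sum_{i,j}(h_{i,j}\ln h_{i,j}-h_{i,j})$ put $h^*(y)=\arg\min_{h\in\mathcal H}g^\eta(h,y)$ and $F(y)=f(h^*(y),y)$. Norms are Euclidean, and spectral for matrices. Write $\mathrm{KL}(h,h')=\sum_{i,j}\big(h_{i,j}\ln\frac{h_{i,j}}{h'_{i,j}}-(h_{i,j}-h'_{i,j})\big)$. *Assumptions.* On $\mathcal H\times\mathcal C$: $f$ is differentiable, $\nabla f$ is $L_f$-Lipschitz and $\|\nabla f\|\le\Omega_f$. On an open neighbourhood of $\mathcal H\times\mathcal C$, $\nabla_h g$ exists and is continuously differentiable in $(h,y)$. For every $y\in\mathcal C$, on $\mathcal H$: $g(\cdot,y)$ is convex,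 $\nabla_hg$ is $L_g$-Lipschitz in $h$, $\|\nabla_hg\|\le\Omega_g$, $\|\nabla_h^2g\|\le L_g$, $\|\nabla_y\nabla_hg\|\le\Lambda$, and $\nabla_y\nabla_hg$, $\nabla_h^2g$ are $\tau^h$-, $\rho^h$-Lipschitz in $h$; for every $h\in\mathcal H$ they are $\tau^y$-, $\rho^y$-Lipschitz in $y\in\mathcal C$. *Algorithm.* Let $\nu=e^{-2\Omega_g/\eta}/\max_id_i$. Start from $y^0\in\mathcal C$ and $h^{0,0}\in\mathcal H$ with all entries $\ge\nu$. For $k\ge0$ set $h^{k,0}=h^{k-1,D}$ if $k>0$, and $R_{k,0}=0$. For $0\le t<D$ put $h^{k,t+1}=T(h^{k,t},y^k)$, where $T(h,y)_i=\dfrac{h_i\circ\exp(-\alpha\nabla_{h_i}g^\eta(h,y))}{h_i^\top\exp(-\alpha\nabla_{h_i}g^\eta(h,y))}$, and $R_{k,t+1}=\partial_hT(h^{k,t},y^k)R_{k,t}+\partial_yT(h^{k,t},y^k)$. Finally put $\widehat\nabla F(y^k)=\nabla_yf(h^{k,D},y^k)+R_{k,D}^\top\nabla_hf(h^{k,D},y^k)$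 and $y^{k+1}=\mathrm{Proj}_{\mathcal C}(y^k-\beta_k\widehat\nabla F(y^k))$. *Constants.* Let $\bar\alpha=\min\{(L_g+\eta/\nu)^{-1},(2L_g^2/\eta+2\eta)^{-1}\}$, $\gamma=1-(1-\eta\alpha)^D$ and $\lambda=1-\eta\alpha/2$. Let $C_0>0$ be such that $\|\partial h^*/\partial y\|\le C_0$ on $\mathcal C$. **Lemma.** The maps $h^*$ and $F$ are differentiable at every $y\in\mathcal C$, and $\|\partial h^*/\partial y\|\le 4\Lambda/(\eta\sqrt{\nu})$ there, so such a $C_0$ exists. Let $0<\alpha\le\bar\alpha$. There are $T^0\in\mathbb N$ and $\Gamma_1,\Gamma_2>0$, depending only on $N,(d_i),m,\eta,\alpha,L_g,\Omega_g,\tau^h,\rho^h,\Lambda,\tau^y,\rho^y,C_0$, such that with $$C_1^D=3\Omega_f^2\Gamma_1\lambda^D,\qquad C_2^D=6L_f^2(1+C_0^2)(1-\eta\alpha)^D+3\Omega_f^2\Gamma_2\lambda^D$$ the following holds. There is an integer $D^0\ge T^0$ such that $\gamma\ge 4/9$ and $C_2^D\le 1/2$ for all $D\ge D^0$. For every such $D^0$,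 every $D\ge D^0$, all step sizes $0<\beta_k\le\frac{\nu\gamma}{3\sqrt2\,C_0}$ and every run of the algorithm, the vectors $z^{k+1}$ defined by $\beta_kz^{k+1}=y^k-\beta_k\widehat\nabla F(y^k)-y^{k+1}$ satisfy $z^{k+1}\in N_{\mathcal C}(y^{k+1})$, and for all $k\ge0$ $$\|\widehat\nabla F(y^k)-\nabla F(y^k)\|^2\le C_1^D(1+C_2^D)+C_2^D\Big(1-\frac\gamma4\Big)^k\mathrm{KL}\big(h^*(y^0),h^{0,0}\big)+C_2^D\,\frac\gamma4\sum_{\ell=0}^{k-1}\Big(1-\frac\gamma4\Big)^{k-1-\ell}\|\nabla F(y^\ell)+z^{\ell+1}\|^2 .$$ -/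

import Mathlib

namespace Botec

noncomputable section

/-! ### Spaces, feasible sets, entropy and Kullback-Leibler divergence -/

/-- The space of lower-level variables `h = (h_i)_i`, `h_i ∈ ℝ^(d i)`, with its Euclidean norm. -/
abbrev LowerSpace {N : ℕ} (d : Fin N → ℕ) : Type :=
  EuclideanSpace ℝ (Σ i : Fin N, Fin (d i))

/-- The space of upper-level variables, with its Euclidean norm. -/
abbrev UpperSpace (m : ℕ) : Type := EuclideanSpace ℝ (Fin m)

/-- The space of joint variables `(h, y)`, with the Euclidean norm
`‖(h, y)‖ ^ 2 = ‖h‖ ^ 2 + ‖y‖ ^ 2`. -/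
abbrev JointSpace {N : ℕ} (d : Fin N → ℕ) (m : ℕ) : Type :=
  WithLp 2 (LowerSpace d × UpperSpace m)

variable {N m : ℕ} {d : Fin N → ℕ}

/-- The product of simplices. -/
def simplices (d : Fin N → ℕ) : Set (LowerSpace d) :=
  {h | (∀ p, 0 ≤ h p) ∧ ∀ i, ∑ j : Fin (d i), h ⟨i, j⟩ = 1}

/-- The product of simplices truncated at level `ν`. -/
def truncSimplices (d : Fin N → ℕ) (ν : ℝ) : Set (LowerSpace d) :=
  {h | (∀ p, ν ≤ h p) ∧ ∀ i, ∑ j : Fin (d i), h ⟨i, j⟩ = 1}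

/-- The level `exp (-2 Ωg / η) / max_i d_i`. -/
def nuMin (d : Fin N → ℕ) (η Ωg : ℝ) : ℝ :=
  Real.exp (-(2 * Ωg) / η) / ((Finset.univ.sup d : ℕ) : ℝ)

/-- The sum of the negative Shannon entropies of the blocks. -/
def negEntropy (h : LowerSpace d) : ℝ :=
  ∑ p, (h p * Real.log (h p) - h p)

/-- The sum over the blocks of the Kullback-Leibler divergences. -/
def klDiv (h h' : LowerSpace d) : ℝ :=
  ∑ p, (h p * Real.log (h p / h' p) - (h p - h' p))

/-- The normal cone to `C` at `y`. -/
def normalCone (C : Set (UpperSpace m)) (y : UpperSpace m) : Set (UpperSpace m) :=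
  {p | ∀ y' ∈ C, inner ℝ p (y' - y) ≤ 0}

/-! ### Derivatives of the lower-level objective and the bilevel objective -/

/-- The partial gradient `∇_h g (h, y)`. -/
def gradH (g : LowerSpace d → UpperSpace m → ℝ) (h : LowerSpace d) (y : UpperSpace m) :
    LowerSpace d :=
  gradient (fun h' => g h' y) h

/-- The Hessian `∇²_h g (h, y)`, as a linear map. -/
def hessH (g : LowerSpace d → UpperSpace m → ℝ) (h : LowerSpace d) (y : UpperSpace m) :
    LowerSpace d →L[ℝ] LowerSpace d :=
  fderiv ℝ (fun h' => gradH g h' y) h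

/-- The cross Hessian `∇_y ∇_h g (h, y)`, as a linear map. -/
def crossHess (g : LowerSpace d → UpperSpace m → ℝ) (h : LowerSpace d) (y : UpperSpace m) :
    UpperSpace m →L[ℝ] LowerSpace d :=
  fderiv ℝ (fun y' => gradH g h y') y

/-- The regularized lower-level objective `g + η ψ`. -/
def gEta (g : LowerSpace d → UpperSpace m → ℝ) (η : ℝ) (h : LowerSpace d)
    (y : UpperSpace m) : ℝ :=
  g h y + η * negEntropy h

/-- The lower-level solution `h⋆(y)`: a minimizer of `gEta g η · y` over the product of simplices
(an arbitrary vector if there is none). -/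
def hStar (g : LowerSpace d → UpperSpace m → ℝ) (η : ℝ) (y : UpperSpace m) : LowerSpace d :=
  Classical.epsilon fun h =>
    h ∈ simplices d ∧ ∀ h' ∈ simplices d, gEta g η h y ≤ gEta g η h' y

/-- The bilevel objective `F(y) = f(h⋆(y), y)`. -/
def bilevelObj (f : JointSpace d m → ℝ) (g : LowerSpace d → UpperSpace m → ℝ) (η : ℝ)
    (y : UpperSpace m) : ℝ :=
  f (WithLp.toLp 2 (hStar g η y, y))

/-! ### Assumptions on the data -/

/-- Upper-level assumptions: `∇f` exists on `H × C`, is `Lf`-Lipschitz and bounded by `Ωf`. -/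
structure UpperAssumptions (C : Set (UpperSpace m)) (f : JointSpace d m → ℝ)
    (Lf Ωf : ℝ) : Prop where
  differentiableAt : ∀ h ∈ simplices d, ∀ y ∈ C, DifferentiableAt ℝ f (WithLp.toLp 2 (h, y))
  lipschitz : ∀ h ∈ simplices d, ∀ y ∈ C, ∀ h' ∈ simplices d, ∀ y' ∈ C,
    ‖gradient f (WithLp.toLp 2 (h, y)) - gradient f (WithLp.toLp 2 (h', y'))‖ ≤
      Lf * ‖(WithLp.toLp 2 (h, y) : JointSpace d m) - WithLp.toLp 2 (h', y')‖
  bounded : ∀ h ∈ simplices d, ∀ y ∈ C, ‖gradient f (WithLp.toLp 2 (h, y))‖ ≤ Ωf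

/-- Lower-level assumptions. The field `regular` says that the derivatives `∇_h g`, `∇²_h g` and
`∇_y ∇_h g` really exist (and are continuous) around `H × C`. -/
structure LowerAssumptions (C : Set (UpperSpace m)) (g : LowerSpace d → UpperSpace m → ℝ)
    (Lg Ωg τh ρh Λ τy ρy : ℝ) : Prop where
  regular : ∃ U : Set (LowerSpace d × UpperSpace m), IsOpen U ∧ simplices d ×ˢ C ⊆ U ∧
    (∀ p ∈ U, DifferentiableAt ℝ (fun h => g h p.2) p.1) ∧
    ContDiffOn ℝ 1 (fun p : LowerSpace d × UpperSpace m => gradH g p.1 p.2) U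
  convex : ∀ y ∈ C, ConvexOn ℝ (simplices d) (fun h => g h y)
  grad_lipschitz : ∀ y ∈ C, ∀ h ∈ simplices d, ∀ h' ∈ simplices d,
    ‖gradH g h y - gradH g h' y‖ ≤ Lg * ‖h - h'‖
  grad_bounded : ∀ y ∈ C, ∀ h ∈ simplices d, ‖gradH g h y‖ ≤ Ωg
  cross_lipschitz_h : ∀ y ∈ C, ∀ h ∈ simplices d, ∀ h' ∈ simplices d,
    ‖crossHess g h y - crossHess g h' y‖ ≤ τh * ‖h - h'‖
  hess_lipschitz_h : ∀ y ∈ C, ∀ h ∈ simplices d, ∀ h' ∈ simplices d,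
    ‖hessH g h y - hessH g h' y‖ ≤ ρh * ‖h - h'‖
  hess_bounded : ∀ y ∈ C, ∀ h ∈ simplices d, ‖hessH g h y‖ ≤ Lg
  cross_bounded : ∀ y ∈ C, ∀ h ∈ simplices d, ‖crossHess g h y‖ ≤ Λ
  cross_lipschitz_y : ∀ h ∈ simplices d, ∀ y ∈ C, ∀ y' ∈ C,
    ‖crossHess g h y - crossHess g h y'‖ ≤ τy * ‖y - y'‖
  hess_lipschitz_y : ∀ h ∈ simplices d, ∀ y ∈ C, ∀ y' ∈ C,
    ‖hessH g h y - hessH g h y'‖ ≤ ρy * ‖y - y'‖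

/-! ### The algorithm -/

/-- One step of mirror descent on the product of simplices, in closed form:
`h_i ∘ exp (-α ∇_{h_i} g^η) / (h_iᵀ exp (-α ∇_{h_i} g^η))` in each block `i`. -/
def pmdStep (g : LowerSpace d → UpperSpace m → ℝ) (η α : ℝ) (h : LowerSpace d)
    (y : UpperSpace m) : LowerSpace d :=
  WithLp.toLp 2 fun p =>
    h p * Real.exp (-α * gradH (gEta g η) h y p) /
      ∑ j : Fin (d p.1), h ⟨p.1, j⟩ * Real.exp (-α * gradH (gEta g η) h y ⟨p.1, j⟩)

/-- The Jacobian update, obtained by differentiating one mirror descent step with respect to `y`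
by the chain rule, where `R` is the current Jacobian of `h` with respect to `y`. -/
def jacStep (g : LowerSpace d → UpperSpace m → ℝ) (η α : ℝ)
    (R : UpperSpace m →L[ℝ] LowerSpace d) (h : LowerSpace d) (y : UpperSpace m) :
    UpperSpace m →L[ℝ] LowerSpace d :=
  (fderiv ℝ (fun h' => pmdStep g η α h' y) h).comp R + fderiv ℝ (fun y' => pmdStep g η α h y') y

/-- The hypergradient estimator `∇_y f(h, y) + Rᵀ ∇_h f(h, y)`. -/
def hyperGrad (f : JointSpace d m → ℝ) (R : UpperSpace m →L[ℝ] LowerSpace d)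
    (h : LowerSpace d) (y : UpperSpace m) : UpperSpace m :=
  (gradient f (WithLp.toLp 2 (h, y))).snd +
    ContinuousLinearMap.adjoint R (gradient f (WithLp.toLp 2 (h, y))).fst

/-- The sequences `y k`, `h k t`, `R k t` are generated by projected gradient descent on `C` with
iterative differentiation of `D` mirror descent steps, with lower-level step size `α`, upper-level
step sizes `β k`, and an initial `h 0 0` in the product of simplices truncated at level `ν`. -/
structure IsRun (C : Set (UpperSpace m)) (f : JointSpace d m → ℝ)
    (g : LowerSpace d → UpperSpace m → ℝ) (η ν α : ℝ) (β : ℕ → ℝ) (D : ℕ)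
    (y : ℕ → UpperSpace m) (h : ℕ → ℕ → LowerSpace d)
    (R : ℕ → ℕ → UpperSpace m →L[ℝ] LowerSpace d) : Prop where
  y_init : y 0 ∈ C
  h_init : h 0 0 ∈ truncSimplices d ν
  h_warm : ∀ k, h (k + 1) 0 = h k D
  R_init : ∀ k, R k 0 = 0
  h_step : ∀ k t, t < D → h k (t + 1) = pmdStep g η α (h k t) (y k)
  R_step : ∀ k t, t < D → R k (t + 1) = jacStep g η α (R k t) (h k t) (y k)
  /-- `y (k + 1)` is the projection onto `C` of `y k - β k • (hypergradient estimate)`. -/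
  y_mem : ∀ k, y (k + 1) ∈ C
  y_proj : ∀ k, ∀ w ∈ C,
    ‖y k - β k • hyperGrad f (R k D) (h k D) (y k) - y (k + 1)‖ ≤
      ‖y k - β k • hyperGrad f (R k D) (h k D) (y k) - w‖

/-! ### Constants -/

/-- The bound on the lower-level step size. -/
def alphaBar (η Lg ν : ℝ) : ℝ :=
  min (1 / (Lg + η / ν)) (1 / (2 * Lg ^ 2 / η + 2 * η))

/-- `γ = 1 - (1 - η α) ^ D`. -/
def gammaD (η α : ℝ) (D : ℕ) : ℝ := 1 - (1 - η * α) ^ D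

/-- `λ = 1 - η α / 2`. -/
def lam (η α : ℝ) : ℝ := 1 - η * α / 2

/-- `C₁ᴰ = 3 Ωf² Γ₁ λ ^ D`. -/
def constC1 (η α Ωf Γ₁ : ℝ) (D : ℕ) : ℝ := 3 * Ωf ^ 2 * Γ₁ * lam η α ^ D

/-- `C₂ᴰ = 6 Lf² (1 + C₀²) (1 - η α) ^ D + 3 Ωf² Γ₂ λ ^ D`. -/
def constC2 (η α Lf Ωf C₀ Γ₂ : ℝ) (D : ℕ) : ℝ :=
  6 * Lf ^ 2 * (1 + C₀ ^ 2) * (1 - η * α) ^ D + 3 * Ωf ^ 2 * Γ₂ * lam η α ^ D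

/-- `D₀` is an admissible threshold for the number of lower-level iterations. -/
def IsThreshold (η α Lf Ωf C₀ Γ₂ : ℝ) (T₀ D₀ : ℕ) : Prop :=
  T₀ ≤ D₀ ∧ ∀ D, D₀ ≤ D → 4 / 9 ≤ gammaD η α D ∧ constC2 η α Lf Ωf C₀ Γ₂ D ≤ 1 / 2

end

end Botec

open Botec

/-!
The proof has three layers.

*The lower level.* On the product of simplices the entropy is 1-strongly convex
(`half_sq_norm_le_klDiv`), and its infinite slope at zero entries keeps minimizers in the interior
(`IsLowerMin.pos`), so `h⋆(y)` is characterized by stationarity along the tangent directions, the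
vectors whose blocks sum to zero. Linearizing stationarity gives the derivative of `h⋆`: the
Hessian `∇²_h g + η diag (1 / h⋆)` is positive definite on tangent directions, and a continuous
solution of such a system is differentiable (`hasFDerivAt_of_restricted_system`). This argument
only uses convexity of `g(·, y)` at the point `y ∈ C` where the derivative is taken, which matters
because `g(·, y')` need not be convex for `y' ∉ C`. It also gives `‖∂h⋆/∂y‖ ≤ Λ / η`.

*The inner loop.* Mirror descent keeps all entries above `ν` (`LowerAssumptions.pmdStep_mem`, by
the weighted AM-GM inequality), and since the objective is `η`-strongly convex and `(2 Lg +
η)`-smooth relative to the entropy, `KL(h⋆, h_t)` decays like `(1 - η α) ^ t`. A mirror descent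
step is a softmax, whose Jacobian is the covariance matrix `diag p - p pᵀ` of its value `p`; on
tangent directions this inverts `diag (1 / p)`. Hence at `h⋆` the Jacobian recursion contracts by
`√(1 - η α)` in the metric `diag (1 / h⋆)` (`norm_invSqrt_contraction`). Along the iterates it is
perturbed by terms of order `‖h_t - h⋆‖`, which decay geometrically, so the Jacobian error still
decays at the slower rate `√λ` (`LowerAssumptions.sq_norm_jac_sub_le`). As the divergence is
bounded on the truncated simplices, the constant in this bound is uniform.

*The outer loop.* Both estimates together bound the squared hypergradient error by `C₁ + C₂ K_k`,
where `K_k = KL(h⋆(y_k), h_{k,0})`. The warm start makes `K_k` satisfy `K_{k+1} ≤ (1 - γ/4) K_k +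
(γ/4) (‖∇F(y_k) + z_{k+1}‖² + C₁)`: the inner loop contributes the factor `1 - γ`, and moving the
target from `h⋆(y_k)` to `h⋆(y_{k+1})` costs a multiple of `‖y_{k+1} - y_k‖² = β_k² ‖F̂_k +
z_{k+1}‖²`, with `F̂_k` the hypergradient estimate, which the bound on `β_k` makes small
(`IsRun.klDiv_succ_le`). Unrolling this recursion gives the claim.
-/

namespace Botec

open Filter Topology

variable {N m : ℕ} {d : Fin N → ℕ}

/-! ### Scalar inequalities for the entropy -/

/-- The map `x ↦ log x - x` is monotone on `(0, 1]`. -/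
lemma log_sub_self_mono {b c : ℝ} (hb : 0 < b) (hbc : b ≤ c) (hc : c ≤ 1) :
    Real.log b - b ≤ Real.log c - c := by
  have hc0 : 0 < c := hb.trans_le hbc
  have h1 := Real.log_le_sub_one_of_pos (div_pos hb hc0)
  rw [Real.log_div hb.ne' hc0.ne'] at h1
  have h2 : b / c - 1 ≤ b - c := by
    rw [div_sub_one hc0.ne', div_le_iff₀ hc0]
    nlinarith
  linarith

/-- Strong convexity of the entropy `x log x - x` on `(0, 1]`, as a bound on its Bregman
divergence. -/
lemma half_sq_le_klTerm {a b : ℝ} (ha : 0 < a) (ha1 : a ≤ 1) (hb : 0 < b) (hb1 : b ≤ 1) :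
    (a - b) ^ 2 / 2 ≤ a * Real.log (a / b) - (a - b) := by
  -- The function `φ x = x log x - x - x² / 2` is convex on `(0, 1]`, because its derivative
  -- `log x - x` is monotone there; the claim is that `φ` lies above its tangent at `b`.
  let φ : ℝ → ℝ := fun x => x * Real.log x - x - x ^ 2 / 2
  have hφ : ∀ x, 0 < x → HasDerivAt φ (Real.log x - x) x := by
    intro x hx
    have := ((Real.hasDerivAt_mul_log hx.ne').sub (hasDerivAt_id x)).sub
      ((hasDerivAt_pow 2 x).div_const 2)
    exact this.congr_deriv (by push_cast; ring)
  have key : (Real.log b - b) * (a - b) ≤ φ a - φ b := by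
    rcases lt_trichotomy a b with h | h | h
    · obtain ⟨c, hc, hc'⟩ := exists_hasDerivAt_eq_slope φ (fun x => Real.log x - x) h
        (fun x hx => (hφ x (ha.trans_le hx.1)).continuousAt.continuousWithinAt)
        (fun x hx => hφ x (ha.trans hx.1))
      have hm := log_sub_self_mono (ha.trans hc.1) hc.2.le hb1
      rw [eq_div_iff (sub_ne_zero.2 h.ne')] at hc'
      nlinarith [mul_le_mul_of_nonneg_right hm (sub_nonneg.2 h.le)]
    · simp [h]
    · obtain ⟨c, hc, hc'⟩ := exists_hasDerivAt_eq_slope φ (fun x => Real.log x - x) h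
        (fun x hx => (hφ x (hb.trans_le hx.1)).continuousAt.continuousWithinAt)
        (fun x hx => hφ x (hb.trans hx.1))
      have hm := log_sub_self_mono hb hc.1.le (hc.2.le.trans ha1)
      rw [eq_div_iff (sub_ne_zero.2 h.ne')] at hc'
      nlinarith [mul_le_mul_of_nonneg_right hm (sub_nonneg.2 h.le)]
  rw [Real.log_div ha.ne' hb.ne']
  simp only [φ] at key
  nlinarith

/-- The Bregman divergence of the entropy is bounded by the chi-squared divergence. -/
lemma klTerm_le_sq_div {a b : ℝ} (ha : 0 < a) (hb : 0 < b) :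
    a * Real.log (a / b) - (a - b) ≤ (a - b) ^ 2 / b := by
  have h1 := Real.log_le_sub_one_of_pos (div_pos ha hb)
  have h2 := mul_le_mul_of_nonneg_left h1 ha.le
  have h3 : a * (a / b - 1) - (a - b) = (a - b) ^ 2 / b := by
    field_simp
  linarith

lemma log_sub_log_le {a b : ℝ} (ha : 0 < a) (hb : 0 < b) :
    Real.log a - Real.log b ≤ (a - b) / b := by
  have h1 := Real.log_le_sub_one_of_pos (div_pos ha hb)
  rw [Real.log_div ha.ne' hb.ne'] at h1
  rwa [sub_div, div_self hb.ne']

lemma abs_log_sub_log_le {a b ν : ℝ} (hν : 0 < ν) (ha : ν ≤ a) (hb : ν ≤ b) :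
    |Real.log a - Real.log b| ≤ |a - b| / ν := by
  have ha0 := hν.trans_le ha
  have hb0 := hν.trans_le hb
  have key : ∀ {x y : ℝ}, ν ≤ x → ν ≤ y → Real.log x - Real.log y ≤ |x - y| / ν := by
    intro x y hx hy
    refine (log_sub_log_le (hν.trans_le hx) (hν.trans_le hy)).trans ?_
    exact (div_le_div_of_nonneg_right (le_abs_self _) (hν.trans_le hy).le).trans
      (div_le_div_of_nonneg_left (abs_nonneg _) hν hy)
  refine abs_sub_le_iff.2 ⟨key ha hb, ?_⟩
  rw [abs_sub_comm]
  exact key hb ha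

lemma abs_inv_sub_inv_le {a b ν : ℝ} (hν : 0 < ν) (ha : ν ≤ a) (hb : ν ≤ b) :
    |a⁻¹ - b⁻¹| ≤ |a - b| / ν ^ 2 := by
  have ha0 := hν.trans_le ha
  have hb0 := hν.trans_le hb
  rw [inv_sub_inv ha0.ne' hb0.ne', abs_div, abs_sub_comm, abs_of_pos (mul_pos ha0 hb0)]
  refine div_le_div_of_nonneg_left (abs_nonneg _) (by positivity) ?_
  nlinarith [mul_le_mul ha hb hν.le ha0.le]

/-! ### Vectors indexed by blocks -/

/-- Entrywise logarithm. -/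
noncomputable def logVec (h : LowerSpace d) : LowerSpace d :=
  WithLp.toLp 2 fun p => Real.log (h p)

@[simp] lemma logVec_apply (h : LowerSpace d) (p : Σ i : Fin N, Fin (d i)) :
    logVec h p = Real.log (h p) := rfl

/-- The directions tangent to the product of simplices: the entries of each block sum to zero. -/
def tangentSpace (d : Fin N → ℕ) : Submodule ℝ (LowerSpace d) where
  carrier := {v | ∀ i, ∑ j : Fin (d i), v ⟨i, j⟩ = 0}
  add_mem' := by
    intro a b ha hb i
    simp only [PiLp.add_apply, Finset.sum_add_distrib, ha i, hb i, add_zero]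
  zero_mem' := by simp
  smul_mem' := by
    intro c a ha i
    simp only [PiLp.smul_apply, smul_eq_mul, ← Finset.mul_sum, ha i, mul_zero]

lemma mem_tangentSpace {v : LowerSpace d} :
    v ∈ tangentSpace d ↔ ∀ i, ∑ j : Fin (d i), v ⟨i, j⟩ = 0 := Iff.rfl

lemma inner_eq_sum (a b : LowerSpace d) : inner ℝ a b = ∑ p, a p * b p := by
  rw [PiLp.inner_apply]
  exact Finset.sum_congr rfl fun p _ => by simp [mul_comm]

lemma sq_norm_eq_sum (a : LowerSpace d) : ‖a‖ ^ 2 = ∑ p, a p ^ 2 := by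
  rw [EuclideanSpace.norm_sq_eq]
  simp

lemma abs_apply_le_norm (a : LowerSpace d) (p : Σ i : Fin N, Fin (d i)) : |a p| ≤ ‖a‖ := by
  have := PiLp.norm_apply_le a p
  simpa using this

lemma norm_le_mul_norm_of_abs_le {a : LowerSpace d} {x : ℝ} {w : LowerSpace d} (hx : 0 ≤ x)
    (h : ∀ p, |a p| ≤ x * |w p|) : ‖a‖ ≤ x * ‖w‖ := by
  refine le_of_sq_le_sq ?_ (by positivity)
  rw [mul_pow, sq_norm_eq_sum, sq_norm_eq_sum, Finset.mul_sum]
  refine Finset.sum_le_sum fun p _ => ?_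
  rw [← mul_pow, ← sq_abs, ← sq_abs (x * w p), abs_mul, abs_of_nonneg hx]
  exact pow_le_pow_left₀ (abs_nonneg _) (h p) 2

lemma norm_le_of_abs_le {a : LowerSpace d} {x : ℝ} (hx : 0 ≤ x) (h : ∀ p, |a p| ≤ x) :
    ‖a‖ ≤ √(Fintype.card (Σ i : Fin N, Fin (d i))) * x := by
  refine le_of_sq_le_sq ?_ (by positivity)
  rw [mul_pow, Real.sq_sqrt (by positivity), sq_norm_eq_sum]
  calc ∑ p, a p ^ 2 ≤ ∑ _p : (Σ i : Fin N, Fin (d i)), x ^ 2 := by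
        refine Finset.sum_le_sum fun p _ => ?_
        rw [← sq_abs]
        exact pow_le_pow_left₀ (abs_nonneg _) (h p) 2
    _ = _ := by simp

lemma truncSimplices_subset {ν : ℝ} (hν : 0 ≤ ν) : truncSimplices d ν ⊆ simplices d :=
  fun _ hh => ⟨fun p => hν.trans (hh.1 p), hh.2⟩

lemma simplices_le_one {h : LowerSpace d} (hh : h ∈ simplices d)
    (p : Σ i : Fin N, Fin (d i)) : h p ≤ 1 := by
  rw [← hh.2 p.1]
  exact Finset.single_le_sum (f := fun j => h ⟨p.1, j⟩) (fun j _ => hh.1 _) (Finset.mem_univ p.2)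

lemma sub_mem_tangentSpace {h h' : LowerSpace d} (hh : h ∈ simplices d) (hh' : h' ∈ simplices d) :
    h - h' ∈ tangentSpace d := fun i => by
  simp only [PiLp.sub_apply, Finset.sum_sub_distrib, hh.2 i, hh'.2 i, sub_self]

lemma isCompact_simplices : IsCompact (simplices d) := by
  refine Metric.isCompact_of_isClosed_isBounded ?_ ?_
  · have : simplices d = (⋂ p, {h : LowerSpace d | 0 ≤ h p}) ∩
        ⋂ i, {h : LowerSpace d | ∑ j : Fin (d i), h ⟨i, j⟩ = 1} := by
      ext h
      simp [simplices]
    rw [this]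
    refine (isClosed_iInter fun p => isClosed_le continuous_const (by fun_prop)).inter
      (isClosed_iInter fun i => isClosed_eq (by fun_prop) continuous_const)
  · refine isBounded_iff_forall_norm_le.2 ⟨_, fun h hh =>
      norm_le_of_abs_le (x := 1) zero_le_one fun p => ?_⟩
    rw [abs_of_nonneg (hh.1 p)]
    exact simplices_le_one hh p

lemma simplices_nonempty (hd : ∀ i, 0 < d i) : (simplices d).Nonempty := by
  refine ⟨WithLp.toLp 2 fun p => 1 / (d p.1 : ℝ), fun p => by simp, fun i => ?_⟩
  have : (d i : ℝ) ≠ 0 := by exact_mod_cast (hd i).ne'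
  simp [this]

/-! ### Kullback-Leibler divergence -/

lemma klDiv_three_point {a b c : LowerSpace d} (ha : ∀ p, 0 < a p) (hb : ∀ p, 0 < b p)
    (hc : ∀ p, 0 < c p) :
    klDiv a c = klDiv a b + klDiv b c + inner ℝ (logVec b - logVec c) (a - b) := by
  rw [inner_eq_sum]
  simp only [klDiv, ← Finset.sum_add_distrib]
  refine Finset.sum_congr rfl fun p _ => ?_
  rw [Real.log_div (ha p).ne' (hb p).ne', Real.log_div (ha p).ne' (hc p).ne',
    Real.log_div (hb p).ne' (hc p).ne']
  simp only [PiLp.sub_apply, logVec_apply]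
  ring

/-- A form of Pinsker's inequality: the entropy is strongly convex on the simplex. -/
lemma half_sq_norm_le_klDiv {a b : LowerSpace d} (ha : ∀ p, 0 < a p) (ha1 : ∀ p, a p ≤ 1)
    (hb : ∀ p, 0 < b p) (hb1 : ∀ p, b p ≤ 1) : ‖a - b‖ ^ 2 / 2 ≤ klDiv a b := by
  rw [sq_norm_eq_sum, Finset.sum_div]
  exact Finset.sum_le_sum fun p _ => half_sq_le_klTerm (ha p) (ha1 p) (hb p) (hb1 p)

lemma klDiv_le_sq_norm {a b : LowerSpace d} {ν : ℝ} (hν : 0 < ν) (ha : ∀ p, 0 < a p)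
    (hb : ∀ p, ν ≤ b p) : klDiv a b ≤ ‖a - b‖ ^ 2 / ν := by
  rw [sq_norm_eq_sum, Finset.sum_div]
  refine Finset.sum_le_sum fun p _ => (klTerm_le_sq_div (ha p) (hν.trans_le (hb p))).trans ?_
  exact div_le_div_of_nonneg_left (sq_nonneg _) hν (hb p)

lemma sq_norm_le_inner_logVec {a b : LowerSpace d} (ha : ∀ p, 0 < a p) (ha1 : ∀ p, a p ≤ 1)
    (hb : ∀ p, 0 < b p) (hb1 : ∀ p, b p ≤ 1) :
    ‖a - b‖ ^ 2 ≤ inner ℝ (logVec a - logVec b) (a - b) := by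
  have h1 := half_sq_norm_le_klDiv ha ha1 hb hb1
  have h2 := half_sq_norm_le_klDiv hb hb1 ha ha1
  have h3 := klDiv_three_point ha hb ha
  have h4 : klDiv a a = 0 := by
    refine Finset.sum_eq_zero fun p _ => ?_
    rw [div_self (ha p).ne']
    simp
  rw [norm_sub_rev] at h2
  have h5 : inner ℝ (logVec b - logVec a) (a - b) = - inner ℝ (logVec a - logVec b) (a - b) := by
    rw [← inner_neg_left, neg_sub]
  linarith

lemma norm_logVec_sub_le {a b : LowerSpace d} {ν : ℝ} (hν : 0 < ν) (ha : ∀ p, ν ≤ a p)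
    (hb : ∀ p, ν ≤ b p) : ‖logVec a - logVec b‖ ≤ ν⁻¹ * ‖a - b‖ :=
  norm_le_mul_norm_of_abs_le (by positivity) fun p => by
    have := abs_log_sub_log_le hν (ha p) (hb p)
    rwa [div_eq_inv_mul] at this

/-- On the truncated simplex the divergence is uniformly bounded. -/
lemma klDiv_le_card_div {a b : LowerSpace d} {ν : ℝ} (hν : 0 < ν) (ha : a ∈ truncSimplices d ν)
    (hb : b ∈ truncSimplices d ν) :
    klDiv a b ≤ Fintype.card (Σ i : Fin N, Fin (d i)) / ν := by
  have ha' := truncSimplices_subset hν.le ha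
  have hb' := truncSimplices_subset hν.le hb
  refine (klDiv_le_sq_norm hν (fun p => hν.trans_le (ha.1 p)) hb.1).trans ?_
  refine div_le_div_of_nonneg_right ?_ hν.le
  have h1 := norm_le_of_abs_le (a := a - b) (x := 1) zero_le_one fun p => by
    have := ha'.1 p
    have := hb'.1 p
    have := simplices_le_one ha' p
    have := simplices_le_one hb' p
    simp only [PiLp.sub_apply]
    exact abs_le.2 ⟨by linarith, by linarith⟩
  have h2 := pow_le_pow_left₀ (norm_nonneg _) h1 2
  rwa [mul_one, Real.sq_sqrt (by positivity)] at h2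

/-! ### Softmax and its Jacobian -/

/-- Entrywise multiplication by `w`, that is the diagonal matrix with diagonal `w`. -/
noncomputable def scaling (w : LowerSpace d) : LowerSpace d →L[ℝ] LowerSpace d :=
  LinearMap.toContinuousLinearMap
    { toFun := fun v => WithLp.toLp 2 fun p => w p * v p
      map_add' := fun a b => by ext p; simp [mul_add]
      map_smul' := fun c a => by ext p; simp; ring }

/-- The block diagonal matrix with blocks `diag p_i - p_i p_iᵀ`, the covariance matrices of the
distributions `p_i`. -/
noncomputable def blockCov (p : LowerSpace d) : LowerSpace d →L[ℝ] LowerSpace d :=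
  LinearMap.toContinuousLinearMap
    { toFun := fun x => WithLp.toLp 2 fun a =>
        p a * (x a - ∑ j : Fin (d a.1), p ⟨a.1, j⟩ * x ⟨a.1, j⟩)
      map_add' := fun x y => by
        ext a; simp [mul_add, Finset.sum_add_distrib]; ring
      map_smul' := fun c x => by
        ext a
        simp only [PiLp.smul_apply, smul_eq_mul, RingHom.id_apply, mul_left_comm _ c,
          ← Finset.mul_sum]
        ring }

lemma blockCov_apply (p x : LowerSpace d) (a : Σ i : Fin N, Fin (d i)) :
    blockCov p x a = p a * (x a - ∑ j : Fin (d a.1), p ⟨a.1, j⟩ * x ⟨a.1, j⟩) := rfl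

/-- Softmax in each block. -/
noncomputable def blockSoftmax (x : LowerSpace d) : LowerSpace d :=
  WithLp.toLp 2 fun p => Real.exp (x p) / ∑ j : Fin (d p.1), Real.exp (x ⟨p.1, j⟩)

lemma blockSoftmax_apply (x : LowerSpace d) (p : Σ i : Fin N, Fin (d i)) :
    blockSoftmax x p = Real.exp (x p) / ∑ j : Fin (d p.1), Real.exp (x ⟨p.1, j⟩) := rfl

lemma sum_exp_pos (x : LowerSpace d) (p : Σ i : Fin N, Fin (d i)) :
    0 < ∑ j : Fin (d p.1), Real.exp (x ⟨p.1, j⟩) :=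
  Finset.sum_pos (fun _ _ => Real.exp_pos _) ⟨p.2, Finset.mem_univ _⟩

lemma blockSoftmax_pos (x : LowerSpace d) (p : Σ i : Fin N, Fin (d i)) : 0 < blockSoftmax x p :=
  div_pos (Real.exp_pos _) (sum_exp_pos x p)

lemma blockSoftmax_mem_simplices (hd : ∀ i, 0 < d i) (x : LowerSpace d) :
    blockSoftmax x ∈ simplices d := by
  refine ⟨fun p => (blockSoftmax_pos x p).le, fun i => ?_⟩
  change ∑ j, Real.exp (x ⟨i, j⟩) / ∑ k : Fin (d i), Real.exp (x ⟨i, k⟩) = 1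
  rw [← Finset.sum_div]
  exact div_self (sum_exp_pos x ⟨i, ⟨0, hd i⟩⟩).ne'

lemma hasFDerivAt_of_apply {E : Type*} [NormedAddCommGroup E] [NormedSpace ℝ E]
    {f : E → LowerSpace d} {f' : E →L[ℝ] LowerSpace d} {x : E}
    (h : ∀ p, HasFDerivAt (fun z => f z p)
      ((EuclideanSpace.proj p : LowerSpace d →L[ℝ] ℝ).comp f') x) : HasFDerivAt f f' x := by
  rw [← hasFDerivWithinAt_univ, hasFDerivWithinAt_euclidean]
  exact fun p => (h p).hasFDerivWithinAt

/-- The Jacobian of softmax is the covariance matrix of its value. -/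
lemma hasFDerivAt_blockSoftmax (x : LowerSpace d) :
    HasFDerivAt blockSoftmax (blockCov (blockSoftmax x)) x := by
  refine hasFDerivAt_of_apply fun p => ?_
  have hproj : ∀ q, HasFDerivAt (fun z : LowerSpace d => z q)
      (EuclideanSpace.proj q : LowerSpace d →L[ℝ] ℝ) x := fun q =>
    (EuclideanSpace.proj q : LowerSpace d →L[ℝ] ℝ).hasFDerivAt
  have hsum := HasFDerivAt.fun_sum (u := (Finset.univ : Finset (Fin (d p.1))))
    fun j _ => (hproj ⟨p.1, j⟩).exp
  have hlog : ∀ z : LowerSpace d, blockSoftmax z p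
      = Real.exp (z p - Real.log (∑ j : Fin (d p.1), Real.exp (z ⟨p.1, j⟩))) := fun z => by
    rw [Real.exp_sub, Real.exp_log (sum_exp_pos z p), blockSoftmax_apply]
  have hs := (sum_exp_pos x p).ne'
  simp only [hlog]
  refine ((hproj p).fun_sub (hsum.log hs)).exp.congr_fderiv ?_
  rw [← hlog]
  ext v
  change blockSoftmax x p * (v p - (∑ j : Fin (d p.1), Real.exp (x ⟨p.1, j⟩))⁻¹ *
      (∑ j : Fin (d p.1), Real.exp (x ⟨p.1, j⟩) •
        (EuclideanSpace.proj ⟨p.1, j⟩ : LowerSpace d →L[ℝ] ℝ)) v)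
    = blockSoftmax x p * (v p - ∑ j : Fin (d p.1), blockSoftmax x ⟨p.1, j⟩ * v ⟨p.1, j⟩)
  rw [sum_apply, Finset.mul_sum]
  congr 2
  refine Finset.sum_congr rfl fun j _ => ?_
  rw [smul_apply, smul_eq_mul, blockSoftmax_apply, PiLp.proj_apply]
  ring

/-! ### The metric `diag (1 / p)` on tangent directions -/

/-- Entrywise division by `√p`: `‖invSqrt p v‖` is the norm of `v` in the metric
`diag (1 / p)`, the Hessian of the entropy at `p`. -/
noncomputable def invSqrt (p : LowerSpace d) : LowerSpace d →L[ℝ] LowerSpace d :=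
  scaling (WithLp.toLp 2 fun a => (√(p a))⁻¹)

/-- The diagonal matrix with entries `1 / p`, the Hessian of the entropy at `p`. -/
noncomputable def invScaling (p : LowerSpace d) : LowerSpace d →L[ℝ] LowerSpace d :=
  scaling (WithLp.toLp 2 fun a => (p a)⁻¹)

lemma invSqrt_apply (p v : LowerSpace d) (a : Σ i : Fin N, Fin (d i)) :
    invSqrt p v a = (√(p a))⁻¹ * v a := rfl

lemma invScaling_apply (p v : LowerSpace d) (a : Σ i : Fin N, Fin (d i)) :
    invScaling p v a = (p a)⁻¹ * v a := rfl

lemma inner_invSqrt {p : LowerSpace d} (hp : ∀ a, 0 < p a) (v w : LowerSpace d) :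
    inner ℝ (invSqrt p v) (invSqrt p w) = ∑ a, v a * w a / p a := by
  rw [inner_eq_sum]
  refine Finset.sum_congr rfl fun a _ => ?_
  have h := Real.mul_self_sqrt (hp a).le
  have h0 := (Real.sqrt_pos.2 (hp a)).ne'
  rw [invSqrt_apply, invSqrt_apply, ← h]
  simp only [Real.sqrt_mul_self (Real.sqrt_nonneg _)]
  field_simp

lemma norm_le_norm_invSqrt {p : LowerSpace d} (hp : ∀ a, 0 < p a) (hp1 : ∀ a, p a ≤ 1)
    (v : LowerSpace d) : ‖v‖ ≤ ‖invSqrt p v‖ := by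
  refine (norm_le_mul_norm_of_abs_le zero_le_one fun a => ?_).trans_eq (one_mul _)
  rw [invSqrt_apply, abs_mul, one_mul, abs_of_pos (inv_pos.2 (Real.sqrt_pos.2 (hp a)))]
  exact le_mul_of_one_le_left (abs_nonneg _)
    ((one_le_inv₀ (Real.sqrt_pos.2 (hp a))).2 (Real.sqrt_le_one.2 (hp1 a)))

lemma norm_invSqrt_le {p : LowerSpace d} {ν : ℝ} (hν : 0 < ν) (hp : ∀ a, ν ≤ p a)
    (v : LowerSpace d) : ‖invSqrt p v‖ ≤ (√ν)⁻¹ * ‖v‖ := by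
  refine norm_le_mul_norm_of_abs_le (by positivity) fun a => ?_
  have hpa := hν.trans_le (hp a)
  rw [invSqrt_apply, abs_mul, abs_of_pos (inv_pos.2 (Real.sqrt_pos.2 hpa))]
  exact mul_le_mul_of_nonneg_right
    (inv_anti₀ (Real.sqrt_pos.2 hν) (Real.sqrt_le_sqrt (hp a))) (abs_nonneg _)

lemma norm_invScaling_le {p : LowerSpace d} {ν : ℝ} (hν : 0 < ν) (hp : ∀ a, ν ≤ p a)
    (v : LowerSpace d) : ‖invScaling p v‖ ≤ ν⁻¹ * ‖v‖ := by
  refine norm_le_mul_norm_of_abs_le (by positivity) fun a => ?_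
  have hpa := hν.trans_le (hp a)
  rw [invScaling_apply, abs_mul, abs_of_pos (inv_pos.2 hpa)]
  exact mul_le_mul_of_nonneg_right (inv_anti₀ hν (hp a)) (abs_nonneg _)

lemma norm_invScaling_sub_le {p q : LowerSpace d} {ν : ℝ} (hν : 0 < ν) (hp : ∀ a, ν ≤ p a)
    (hq : ∀ a, ν ≤ q a) (v : LowerSpace d) :
    ‖invScaling p v - invScaling q v‖ ≤ (‖p - q‖ / ν ^ 2) * ‖v‖ := by
  refine norm_le_mul_norm_of_abs_le (by positivity) fun a => ?_
  rw [PiLp.sub_apply, invScaling_apply, invScaling_apply, ← sub_mul, abs_mul]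
  refine mul_le_mul_of_nonneg_right ((abs_inv_sub_inv_le hν (hp a) (hq a)).trans ?_) (abs_nonneg _)
  exact div_le_div_of_nonneg_right (abs_apply_le_norm (p - q) a) (by positivity)

lemma sq_norm_le_inner_invScaling {p : LowerSpace d} (hp : ∀ a, 0 < p a) (hp1 : ∀ a, p a ≤ 1)
    (v : LowerSpace d) : ‖v‖ ^ 2 ≤ inner ℝ (invScaling p v) v := by
  rw [inner_eq_sum, sq_norm_eq_sum]
  refine Finset.sum_le_sum fun a _ => ?_
  rw [invScaling_apply, mul_assoc, ← sq]
  exact le_mul_of_one_le_left (sq_nonneg _) ((one_le_inv₀ (hp a)).2 (hp1 a))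

lemma blockCov_mem_tangentSpace {p : LowerSpace d} (hp : p ∈ simplices d) (x : LowerSpace d) :
    blockCov p x ∈ tangentSpace d := fun i => by
  change ∑ j, p ⟨i, j⟩ * (x ⟨i, j⟩ - ∑ k, p ⟨i, k⟩ * x ⟨i, k⟩) = 0
  simp only [mul_sub, Finset.sum_sub_distrib, ← Finset.sum_mul, hp.2 i, one_mul, sub_self]

/-- On tangent directions, `blockCov p` inverts the Hessian of the entropy. -/
lemma blockCov_invScaling {p : LowerSpace d} (hp : ∀ a, 0 < p a) {v : LowerSpace d}
    (hv : v ∈ tangentSpace d) : blockCov p (invScaling p v) = v := by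
  ext a
  have h : ∀ b, p b * ((p b)⁻¹ * v b) = v b := fun b => mul_inv_cancel_left₀ (hp b).ne' _
  simp only [blockCov_apply, invScaling_apply, h, mem_tangentSpace.1 hv a.1, sub_zero]

lemma inner_blockCov_comm (p x z : LowerSpace d) :
    inner ℝ (blockCov p x) z = inner ℝ x (blockCov p z) := by
  rw [inner_eq_sum, inner_eq_sum, Fintype.sum_sigma, Fintype.sum_sigma]
  refine Finset.sum_congr rfl fun i _ => ?_
  change ∑ j, p ⟨i, j⟩ * (x ⟨i, j⟩ - ∑ k, p ⟨i, k⟩ * x ⟨i, k⟩) * z ⟨i, j⟩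
    = ∑ j, x ⟨i, j⟩ * (p ⟨i, j⟩ * (z ⟨i, j⟩ - ∑ k, p ⟨i, k⟩ * z ⟨i, k⟩))
  have h1 : ∀ u w : LowerSpace d, ∑ j, p ⟨i, j⟩ * (u ⟨i, j⟩ - ∑ k, p ⟨i, k⟩ * u ⟨i, k⟩) * w ⟨i, j⟩
      = ∑ j, p ⟨i, j⟩ * u ⟨i, j⟩ * w ⟨i, j⟩
        - (∑ k, p ⟨i, k⟩ * u ⟨i, k⟩) * ∑ k, p ⟨i, k⟩ * w ⟨i, k⟩ := fun u w => by
    rw [Finset.mul_sum, ← Finset.sum_sub_distrib]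
    exact Finset.sum_congr rfl fun j _ => by ring
  have h2 := h1 z x
  rw [h1 x z]
  simp only [mul_comm (x ⟨i, _⟩), h2, mul_comm (∑ k, p ⟨i, k⟩ * z ⟨i, k⟩)]
  congr 1
  exact Finset.sum_congr rfl fun j _ => by ring

/-- `blockCov p` kills the vectors orthogonal to the tangent directions. -/
lemma blockCov_eq_zero {p : LowerSpace d} (hp : p ∈ simplices d) {x : LowerSpace d}
    (hx : ∀ w ∈ tangentSpace d, inner ℝ x w = 0) : blockCov p x = 0 := by
  rw [← inner_self_eq_zero (𝕜 := ℝ), inner_blockCov_comm]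
  exact hx _ (blockCov_mem_tangentSpace hp _)

lemma inner_invSqrt_blockCov {p : LowerSpace d} (hp : ∀ a, 0 < p a) {v : LowerSpace d}
    (hv : v ∈ tangentSpace d) (x : LowerSpace d) :
    inner ℝ (invSqrt p v) (invSqrt p (blockCov p x)) = inner ℝ v x := by
  rw [inner_invSqrt hp]
  calc ∑ a, v a * blockCov p x a / p a = inner ℝ (invScaling p v) (blockCov p x) := by
        rw [inner_eq_sum]
        exact Finset.sum_congr rfl fun a _ => by rw [invScaling_apply]; ring
    _ = inner ℝ v x := by rw [← inner_blockCov_comm, blockCov_invScaling hp hv]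

/-- The variance is at most the second moment. -/
lemma norm_invSqrt_blockCov_le {p : LowerSpace d} (hp : p ∈ simplices d) (hp0 : ∀ a, 0 < p a)
    (x : LowerSpace d) : ‖invSqrt p (blockCov p x)‖ ≤ ‖x‖ := by
  refine le_of_sq_le_sq ?_ (norm_nonneg _)
  rw [← real_inner_self_eq_norm_sq,
    inner_invSqrt_blockCov hp0 (blockCov_mem_tangentSpace hp x), inner_eq_sum, sq_norm_eq_sum]
  calc ∑ a, blockCov p x a * x a ≤ ∑ a, p a * x a ^ 2 := by
        rw [Fintype.sum_sigma, Fintype.sum_sigma]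
        refine Finset.sum_le_sum fun i _ => ?_
        have : ∑ j, blockCov p x ⟨i, j⟩ * x ⟨i, j⟩
            = ∑ j, p ⟨i, j⟩ * x ⟨i, j⟩ ^ 2 - (∑ j, p ⟨i, j⟩ * x ⟨i, j⟩) ^ 2 := by
          rw [sq (∑ j, p ⟨i, j⟩ * x ⟨i, j⟩), Finset.mul_sum, ← Finset.sum_sub_distrib]
          exact Finset.sum_congr rfl fun j _ => by rw [blockCov_apply]; ring
        rw [this]
        linarith [sq_nonneg (∑ j, p ⟨i, j⟩ * x ⟨i, j⟩)]
    _ ≤ ∑ a, x a ^ 2 := Finset.sum_le_sum fun a _ =>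
        mul_le_of_le_one_left (sq_nonneg _) (simplices_le_one hp a)

lemma abs_sum_block_le (w x : LowerSpace d) (i : Fin N) :
    |∑ j, w ⟨i, j⟩ * x ⟨i, j⟩| ≤ ‖w‖ * ‖x‖ := by
  have hblock : ∀ z : LowerSpace d, ∑ j, z ⟨i, j⟩ ^ 2 ≤ ‖z‖ ^ 2 := fun z => by
    rw [sq_norm_eq_sum, Fintype.sum_sigma]
    exact Finset.single_le_sum (f := fun i => ∑ j, z ⟨i, j⟩ ^ 2)
      (fun i _ => Finset.sum_nonneg fun j _ => sq_nonneg _) (Finset.mem_univ i)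
  refine le_of_sq_le_sq ?_ (by positivity)
  rw [sq_abs, mul_pow]
  exact (Finset.sum_mul_sq_le_sq_mul_sq _ _ _).trans (mul_le_mul (hblock w) (hblock x)
    (Finset.sum_nonneg fun j _ => sq_nonneg _) (sq_nonneg _))

/-- Lipschitz continuity of `p ↦ blockCov p`. -/
lemma norm_blockCov_sub_le {p q : LowerSpace d} (hp : p ∈ simplices d) (hq : q ∈ simplices d)
    (x : LowerSpace d) : ‖blockCov p x - blockCov q x‖ ≤
      √(Fintype.card (Σ i : Fin N, Fin (d i))) * 3 * ‖p - q‖ * ‖x‖ := by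
  rw [mul_assoc, mul_assoc]
  refine norm_le_of_abs_le (by positivity) fun a => ?_
  set M := ∑ j, p ⟨a.1, j⟩ * x ⟨a.1, j⟩
  have h1 : blockCov p x a - blockCov q x a = (p - q) a * x a - (p - q) a * M
      - q a * ∑ j, (p - q) ⟨a.1, j⟩ * x ⟨a.1, j⟩ := by
    simp only [blockCov_apply, PiLp.sub_apply, sub_mul, Finset.sum_sub_distrib, M]
    ring
  have hM : |M| ≤ ‖x‖ := by
    calc |M| ≤ ∑ j, p ⟨a.1, j⟩ * ‖x‖ := by
          refine (Finset.abs_sum_le_sum_abs _ _).trans (Finset.sum_le_sum fun j _ => ?_)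
          rw [abs_mul, abs_of_nonneg (hp.1 _)]
          exact mul_le_mul_of_nonneg_left (abs_apply_le_norm x _) (hp.1 _)
      _ = ‖x‖ := by rw [← Finset.sum_mul, hp.2, one_mul]
  have hpq := abs_apply_le_norm (p - q) a
  have e1 : |(p - q) a * x a| ≤ ‖p - q‖ * ‖x‖ := by
    rw [abs_mul]
    exact mul_le_mul hpq (abs_apply_le_norm x a) (abs_nonneg _) (norm_nonneg _)
  have e2 : |(p - q) a * M| ≤ ‖p - q‖ * ‖x‖ := by
    rw [abs_mul]
    exact mul_le_mul hpq hM (abs_nonneg _) (norm_nonneg _)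
  have e3 : |q a * ∑ j, (p - q) ⟨a.1, j⟩ * x ⟨a.1, j⟩| ≤ ‖p - q‖ * ‖x‖ := by
    rw [abs_mul, abs_of_nonneg (hq.1 a)]
    exact (mul_le_of_le_one_left (abs_nonneg _) (simplices_le_one hq a)).trans
      (abs_sum_block_le (p - q) x a.1)
  rw [PiLp.sub_apply, h1]
  refine (abs_sub _ _).trans ?_
  linarith [abs_sub ((p - q) a * x a) ((p - q) a * M)]

/-- The Jacobian of a mirror descent step at its fixed point is a contraction of the tangent
directions in the metric `diag (1 / p)`. -/
lemma norm_invSqrt_contraction {p : LowerSpace d} (hp : p ∈ simplices d) (hp0 : ∀ a, 0 < p a)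
    {η α L : ℝ} (hα : 0 ≤ α) (hηα : η * α ≤ 1) (hL : 0 ≤ L) (hαL : α * (η ^ 2 + L ^ 2) ≤ η)
    (H : LowerSpace d →L[ℝ] LowerSpace d) (hH : ‖H‖ ≤ L) {v : LowerSpace d}
    (hv : v ∈ tangentSpace d) (hHv : 0 ≤ inner ℝ v (H v)) :
    ‖invSqrt p (blockCov p ((1 - η * α) • invScaling p v - α • H v))‖
      ≤ √(1 - η * α) * ‖invSqrt p v‖ := by
  have hs : 0 ≤ 1 - η * α := by linarith
  refine le_of_sq_le_sq ?_ (by positivity)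
  have h1 : ‖invSqrt p (blockCov p (H v))‖ ≤ L * ‖invSqrt p v‖ := by
    refine (norm_invSqrt_blockCov_le hp hp0 _).trans ((H.le_opNorm v).trans ?_)
    exact mul_le_mul hH (norm_le_norm_invSqrt hp0 (simplices_le_one hp) v) (norm_nonneg _) hL
  have h2 := pow_le_pow_left₀ (norm_nonneg _) h1 2
  rw [mul_pow, Real.sq_sqrt hs, map_sub, map_smul, map_smul, blockCov_invScaling hp0 hv, map_sub,
    map_smul, map_smul, norm_sub_sq_real, norm_smul, norm_smul, mul_pow, mul_pow, Real.norm_eq_abs,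
    Real.norm_eq_abs, sq_abs, sq_abs, real_inner_smul_left, real_inner_smul_right,
    inner_invSqrt_blockCov hp0 hv]
  have h3 := mul_le_mul_of_nonneg_left h2 (sq_nonneg α)
  have h4 := mul_le_mul_of_nonneg_right (mul_le_mul_of_nonneg_left hαL hα)
    (sq_nonneg ‖invSqrt p v‖)
  have h5 : 0 ≤ (1 - η * α) * (α * inner ℝ v (H v)) := by positivity
  nlinarith

/-! ### First-order conditions for the regularized lower-level problem -/

/-- The gradient inequality for convex functions. -/
lemma add_inner_gradient_le_of_convexOn {E : Type*} [NormedAddCommGroup E] [InnerProductSpace ℝ E]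
    [CompleteSpace E] {s : Set E} {φ : E → ℝ} (hφ : ConvexOn ℝ s φ) {x x' : E} (hx : x ∈ s)
    (hx' : x' ∈ s) (hd : DifferentiableAt ℝ φ x) :
    φ x + inner ℝ (gradient φ x) (x' - x) ≤ φ x' := by
  have h1 : HasDerivAt (fun t : ℝ => φ (x + t • (x' - x))) (inner ℝ (gradient φ x) (x' - x)) 0 := by
    have := hd.hasFDerivAt.hasLineDerivAt (x' - x)
    rw [HasLineDerivAt, ← inner_gradient_left] at this
    exact this
  have h2 := h1.tendsto_slope_zero_right
  have h3 : inner ℝ (gradient φ x) (x' - x) ≤ φ x' - φ x := by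
    refine le_of_tendsto h2 ?_
    filter_upwards [Ioo_mem_nhdsGT (zero_lt_one' ℝ)] with t ht
    have h4 := hφ.2 hx hx' (sub_nonneg.2 ht.2.le) ht.1.le (by ring)
    have h5 : (1 - t) • x + t • x' = x + t • (x' - x) := by module
    rw [h5, smul_eq_mul, smul_eq_mul] at h4
    simp only [zero_add, zero_smul, add_zero, smul_eq_mul]
    rw [inv_mul_le_iff₀ ht.1]
    linarith
  linarith

lemma eventually_add_smul_mem_simplices {h v : LowerSpace d} (hh : h ∈ simplices d)
    (hh0 : ∀ p, 0 < h p) (hv : v ∈ tangentSpace d) :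
    ∀ᶠ t : ℝ in 𝓝 0, h + t • v ∈ simplices d := by
  have h1 : ∀ p, ∀ᶠ t : ℝ in 𝓝 0, 0 < (h + t • v) p := fun p => by
    have hc : ContinuousAt (fun t : ℝ => (h + t • v) p) 0 := by fun_prop
    exact hc.eventually_const_lt (by simpa using hh0 p)
  filter_upwards [eventually_all.2 h1] with t ht
  refine ⟨fun p => (ht p).le, fun i => ?_⟩
  simp [Finset.sum_add_distrib, ← Finset.mul_sum, hh.2 i, mem_tangentSpace.1 hv i]

lemma continuous_negEntropy : Continuous (negEntropy : LowerSpace d → ℝ) := by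
  unfold negEntropy
  refine continuous_finsetSum _ fun p _ => ?_
  have : Continuous fun h : LowerSpace d => h p := by fun_prop
  exact (Real.continuous_mul_log.comp this).sub this

lemma hasGradientAt_negEntropy {h : LowerSpace d} (hh : ∀ p, 0 < h p) :
    HasGradientAt negEntropy (logVec h) h := by
  rw [hasGradientAt_iff_hasFDerivAt]
  have hproj : ∀ q, HasFDerivAt (fun z : LowerSpace d => z q * Real.log (z q) - z q)
      (Real.log (h q) • (EuclideanSpace.proj q : LowerSpace d →L[ℝ] ℝ)) h := fun q => by
    have h1 := ((Real.hasDerivAt_mul_log (hh q).ne').sub (hasDerivAt_id (h q))).congr_deriv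
      (show Real.log (h q) + 1 - 1 = Real.log (h q) by ring)
    exact h1.comp_hasFDerivAt h
      (EuclideanSpace.proj q : LowerSpace d →L[ℝ] ℝ).hasFDerivAt
  refine (HasFDerivAt.fun_sum (u := Finset.univ) fun q _ => hproj q).congr_fderiv ?_
  ext v
  rw [sum_apply, InnerProductSpace.toDual_apply_apply, inner_eq_sum]
  rfl

lemma gradH_gEta {g : LowerSpace d → UpperSpace m → ℝ} {η : ℝ} {h : LowerSpace d}
    {y : UpperSpace m} (hg : DifferentiableAt ℝ (fun h' => g h' y) h) (hh : ∀ p, 0 < h p) :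
    gradH (gEta g η) h y = gradH g h y + η • logVec h := by
  have h1 := (hasGradientAt_iff_hasFDerivAt.1 hg.hasGradientAt).add
    ((hasGradientAt_iff_hasFDerivAt.1 (hasGradientAt_negEntropy hh)).const_smul η)
  refine HasGradientAt.gradient (hasGradientAt_iff_hasFDerivAt.2 ?_)
  refine h1.congr_fderiv ?_
  rw [map_add, map_smul]
  rfl

/-- `h` minimizes `gEta g η · y` over the product of simplices. -/
def IsLowerMin (g : LowerSpace d → UpperSpace m → ℝ) (η : ℝ) (y : UpperSpace m)
    (h : LowerSpace d) : Prop :=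
  h ∈ simplices d ∧ ∀ h' ∈ simplices d, gEta g η h y ≤ gEta g η h' y

lemma isLowerMin_hStar (hd : ∀ i, 0 < d i) {g : LowerSpace d → UpperSpace m → ℝ} {η : ℝ}
    {y : UpperSpace m} (hg : ∀ h ∈ simplices d, DifferentiableAt ℝ (fun h' => g h' y) h) :
    IsLowerMin g η y (hStar g η y) := by
  have hc : ContinuousOn (fun h => gEta g η h y) (simplices d) := fun h hh =>
    ((hg h hh).continuousAt.add
      (continuous_const.mul continuous_negEntropy).continuousAt).continuousWithinAt
  obtain ⟨h, hh, hmin⟩ := isCompact_simplices.exists_isMinOn (simplices_nonempty hd) hc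
  exact Classical.epsilon_spec (p := fun h => IsLowerMin g η y h) ⟨h, hh, fun h' hh' => hmin hh'⟩

lemma sum_block_single [DecidableEq (Σ i : Fin N, Fin (d i))] (p : Σ i : Fin N, Fin (d i))
    (i : Fin N) :
    ∑ j : Fin (d i), (EuclideanSpace.single p (1 : ℝ) : LowerSpace d) ⟨i, j⟩
      = if p.1 = i then 1 else 0 := by
  obtain ⟨i', j'⟩ := p
  by_cases h : i' = i
  · subst h
    simp [PiLp.single_apply]
  · simp [h, Ne.symm h]

lemma single_sub_single_mem_tangentSpace [DecidableEq (Σ i : Fin N, Fin (d i))]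
    {p q : Σ i : Fin N, Fin (d i)} (h : p.1 = q.1) :
    (EuclideanSpace.single p (1 : ℝ) - EuclideanSpace.single q (1 : ℝ) : LowerSpace d)
      ∈ tangentSpace d := fun i => by
  simp only [PiLp.sub_apply, Finset.sum_sub_distrib, sum_block_single, h, sub_self]

/-- A minimizer of the regularized problem has positive entries: the slope of the entropy at a
zero entry is `-∞`. -/
lemma IsLowerMin.pos {g : LowerSpace d → UpperSpace m → ℝ} {η : ℝ} (hη : 0 < η)
    {y : UpperSpace m} {h : LowerSpace d} (hmin : IsLowerMin g η y h)
    (hg : DifferentiableAt ℝ (fun h' => g h' y) h) (p : Σ i : Fin N, Fin (d i)) : 0 < h p := by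
  classical
  by_contra hp
  have hp0 : h p = 0 := le_antisymm (not_lt.1 hp) (hmin.1.1 p)
  obtain ⟨j, -, hj⟩ : ∃ j ∈ Finset.univ, 0 < h ⟨p.1, j⟩ := by
    refine Finset.exists_lt_of_sum_lt (f := fun _ => (0 : ℝ)) ?_
    rw [hmin.1.2 p.1]
    simp
  -- Mass is moved from the positive entry `q` to the zero entry `p`.
  set q : Σ i : Fin N, Fin (d i) := ⟨p.1, j⟩
  have hqp : q ≠ p := fun hqp => by rw [hqp, hp0] at hj; exact lt_irrefl _ hj
  set v : LowerSpace d := EuclideanSpace.single p 1 - EuclideanSpace.single q 1 with hv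
  have hvt : v ∈ tangentSpace d := single_sub_single_mem_tangentSpace rfl
  have hvp : v p = 1 := by simp [hv, hqp.symm]
  have hvq : v q = -1 := by simp [hv, hqp]
  have hvr : ∀ r, r ≠ p → r ≠ q → v r = 0 := fun r h1 h2 => by
    simp [hv, h1, h2]
  have hmem : ∀ t ∈ Set.Ioo 0 (h q), h + t • v ∈ simplices d := by
    intro t ht
    refine ⟨fun r => ?_, fun i => ?_⟩
    · rw [PiLp.add_apply, PiLp.smul_apply, smul_eq_mul]
      by_cases h1 : r = p
      · rw [h1, hvp, hp0]
        linarith [ht.1]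
      · by_cases h2 : r = q
        · rw [h2, hvq]
          linarith [ht.2]
        · rw [hvr r h1 h2]
          linarith [hmin.1.1 r]
    · simp [Finset.sum_add_distrib, ← Finset.mul_sum, hmin.1.2 i, mem_tangentSpace.1 hvt i]
  let φ : ℝ → ℝ := fun x => x * Real.log x - x
  let G : ℝ → ℝ := fun t => g (h + t • v) y + η * ∑ r ∈ Finset.univ.erase p, φ ((h + t • v) r)
  have hG : DifferentiableAt ℝ G 0 := by
    have h1 : DifferentiableAt ℝ (fun t : ℝ => h + t • v) 0 := by fun_prop
    have h2 : DifferentiableAt ℝ (fun t : ℝ => g (h + t • v) y) 0 := by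
      have : DifferentiableAt ℝ (fun h' => g h' y) (h + (0 : ℝ) • v) := by simpa using hg
      exact this.comp (0 : ℝ) h1
    refine h2.add (DifferentiableAt.const_mul (DifferentiableAt.fun_sum fun r hr => ?_) η)
    by_cases hrq : r = q
    · have h3 : DifferentiableAt ℝ φ ((h + (0 : ℝ) • v) r) := by
        refine (Real.hasDerivAt_mul_log ?_).differentiableAt.sub differentiableAt_id
        simpa [hrq] using hj.ne'
      have h4 : DifferentiableAt ℝ (fun t : ℝ => (h + t • v) r) 0 := by fun_prop
      exact h3.comp (0 : ℝ) h4
    · have h0 := hvr r (Finset.ne_of_mem_erase hr) hrq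
      simp [h0]
  have hsplit : ∀ t : ℝ, gEta g η (h + t • v) y = G t + η * φ t := fun t => by
    have h1 : φ t = φ ((h + t • v) p) := by simp [hp0, hvp]
    simp only [gEta, negEntropy, G]
    rw [h1, add_assoc, ← mul_add, Finset.sum_erase_add _ _ (Finset.mem_univ p)]
  have hlim : Tendsto (fun t : ℝ => t⁻¹ • (G (0 + t) - G 0) + η * (Real.log t + -1)) (𝓝[>] 0)
      atBot :=
    hG.hasDerivAt.tendsto_slope_zero_right.add_atBot
      ((tendsto_atBot_add_const_right _ _ Real.tendsto_log_nhdsGT_zero).const_mul_atBot hη)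
  obtain ⟨t, ht1, ht2⟩ := ((hlim.eventually (eventually_lt_atBot 0)).and
    (Ioo_mem_nhdsGT hj)).exists
  have h1 := hmin.2 _ (hmem t ht2)
  have h2 := hsplit 0
  rw [hsplit t] at h1
  have ht0 := ht2.1
  simp only [zero_smul, add_zero, φ, Real.log_zero, mul_zero, sub_zero] at h2
  rw [h2] at h1
  have h3 : t * (t⁻¹ • (G (0 + t) - G 0) + η * (Real.log t + -1))
      = G t - G 0 + η * (t * Real.log t - t) := by
    rw [zero_add, smul_eq_mul]
    field_simp
    ring
  have h4 := mul_neg_of_pos_of_neg ht0 ht1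
  rw [h3] at h4
  simp only [φ] at h1
  linarith

/-- Stationarity of a minimizer: the gradient is orthogonal to the tangent directions. -/
lemma IsLowerMin.inner_eq_zero {g : LowerSpace d → UpperSpace m → ℝ} {η : ℝ} (hη : 0 < η)
    {y : UpperSpace m} {h : LowerSpace d} (hmin : IsLowerMin g η y h)
    (hg : DifferentiableAt ℝ (fun h' => g h' y) h) {v : LowerSpace d}
    (hv : v ∈ tangentSpace d) : inner ℝ (gradH g h y + η • logVec h) v = 0 := by
  have hpos := hmin.pos hη hg
  have hdiff : DifferentiableAt ℝ (fun h' => gEta g η h' y) h :=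
    hg.add ((hasGradientAt_negEntropy hpos).differentiableAt.const_mul η)
  have h1 : HasDerivAt (fun t : ℝ => gEta g η (h + t • v) y)
      (inner ℝ (gradient (fun h' => gEta g η h' y) h) v) 0 := by
    have := hdiff.hasFDerivAt.hasLineDerivAt v
    rw [HasLineDerivAt, ← inner_gradient_left] at this
    exact this
  rw [← gradH_gEta hg hpos]
  refine IsLocalMin.hasDerivAt_eq_zero ?_ h1
  filter_upwards [eventually_add_smul_mem_simplices hmin.1 hpos hv] with t ht
  simpa using hmin.2 _ ht

lemma nuMin_pos (hN : 0 < N) (hd : ∀ i, 0 < d i) (η Ωg : ℝ) : 0 < nuMin d η Ωg := by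
  have : 0 < Finset.univ.sup d := (hd ⟨0, hN⟩).trans_le (Finset.le_sup (Finset.mem_univ _))
  exact div_pos (Real.exp_pos _) (by exact_mod_cast this)

lemma nuMin_le (hd : ∀ i, 0 < d i) (η Ωg : ℝ) (i : Fin N) :
    nuMin d η Ωg ≤ Real.exp (-(2 * Ωg) / η) / d i := by
  have h1 : (0 : ℝ) < d i := by exact_mod_cast hd i
  refine div_le_div_of_nonneg_left (Real.exp_pos _).le h1 ?_
  exact_mod_cast Finset.le_sup (f := d) (Finset.mem_univ i)

lemma nuMin_le_one (hN : 0 < N) (hd : ∀ i, 0 < d i) {η Ωg : ℝ} (hη : 0 < η) (hΩ : 0 ≤ Ωg) :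
    nuMin d η Ωg ≤ 1 := by
  refine (nuMin_le hd η Ωg ⟨0, hN⟩).trans (div_le_one_of_le₀ ?_ (by positivity))
  refine (Real.exp_le_one_iff.2 ?_).trans (by exact_mod_cast hd _)
  exact div_nonpos_of_nonpos_of_nonneg (by linarith) hη.le

/-- The minimizer is a Gibbs distribution with bounded potential, so its entries are bounded
below. -/
lemma IsLowerMin.mem_truncSimplices (hd : ∀ i, 0 < d i) {g : LowerSpace d → UpperSpace m → ℝ}
    {η Ωg : ℝ} (hη : 0 < η) {y : UpperSpace m} {h : LowerSpace d} (hmin : IsLowerMin g η y h)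
    (hg : DifferentiableAt ℝ (fun h' => g h' y) h) (hΩ : ‖gradH g h y‖ ≤ Ωg) :
    h ∈ truncSimplices d (nuMin d η Ωg) := by
  classical
  refine ⟨fun p => (nuMin_le hd η Ωg p.1).trans ?_, hmin.1.2⟩
  have hpos := hmin.pos hη hg
  have key : ∀ j, h ⟨p.1, j⟩ ≤ Real.exp (2 * Ωg / η) * h p := by
    intro j
    have h1 := hmin.inner_eq_zero hη hg
      (single_sub_single_mem_tangentSpace (p := ⟨p.1, j⟩) (q := p) rfl)
    simp only [inner_sub_right, EuclideanSpace.inner_single_right, PiLp.add_apply,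
      PiLp.smul_apply, logVec_apply, smul_eq_mul, one_mul, conj_trivial] at h1
    have h2 := abs_le.1 ((abs_apply_le_norm (gradH g h y) p).trans hΩ)
    have h3 := abs_le.1 ((abs_apply_le_norm (gradH g h y) ⟨p.1, j⟩).trans hΩ)
    rw [← Real.log_le_log_iff (hpos _) (mul_pos (Real.exp_pos _) (hpos p)),
      Real.log_mul (Real.exp_pos _).ne' (hpos p).ne', Real.log_exp, ← sub_le_iff_le_add,
      le_div_iff₀ hη]
    linarith [h2.1, h2.2, h3.1, h3.2]
  have hsum : (1 : ℝ) ≤ d p.1 * (Real.exp (2 * Ωg / η) * h p) := by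
    rw [← hmin.1.2 p.1]
    simpa using Finset.sum_le_sum fun j (_ : j ∈ Finset.univ) => key j
  have h1 : (0 : ℝ) < d p.1 := by exact_mod_cast hd p.1
  rw [div_le_iff₀ h1, neg_div, Real.exp_neg, inv_le_iff_one_le_mul₀ (Real.exp_pos _)]
  linarith

/-! ### Consequences of the lower-level assumptions -/

section Lower

variable {C : Set (UpperSpace m)} {g : LowerSpace d → UpperSpace m → ℝ}
  {Lg Ωg τh ρh Λ τy ρy : ℝ}

lemma LowerAssumptions.eventually_differentiableAt
    (hg : LowerAssumptions C g Lg Ωg τh ρh Λ τy ρy) {h : LowerSpace d} (hh : h ∈ simplices d)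
    {y : UpperSpace m} (hy : y ∈ C) :
    ∀ᶠ p : LowerSpace d × UpperSpace m in 𝓝 (h, y),
      DifferentiableAt ℝ (fun h => g h p.2) p.1 := by
  obtain ⟨U, hU, hsub, hdiff, -⟩ := hg.regular
  filter_upwards [hU.mem_nhds (hsub ⟨hh, hy⟩)] with p hp using hdiff p hp

lemma LowerAssumptions.differentiableAt (hg : LowerAssumptions C g Lg Ωg τh ρh Λ τy ρy)
    {h : LowerSpace d} (hh : h ∈ simplices d) {y : UpperSpace m} (hy : y ∈ C) :
    DifferentiableAt ℝ (fun h' => g h' y) h :=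
  (hg.eventually_differentiableAt hh hy).self_of_nhds

lemma LowerAssumptions.contDiffAt_gradH (hg : LowerAssumptions C g Lg Ωg τh ρh Λ τy ρy)
    {h : LowerSpace d} (hh : h ∈ simplices d) {y : UpperSpace m} (hy : y ∈ C) :
    ContDiffAt ℝ 1 (fun p : LowerSpace d × UpperSpace m => gradH g p.1 p.2) (h, y) := by
  obtain ⟨U, hU, hsub, -, hC⟩ := hg.regular
  exact hC.contDiffAt (hU.mem_nhds (hsub ⟨hh, hy⟩))

lemma LowerAssumptions.hasFDerivAt_gradH (hg : LowerAssumptions C g Lg Ωg τh ρh Λ τy ρy)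
    {h : LowerSpace d} (hh : h ∈ simplices d) {y : UpperSpace m} (hy : y ∈ C) :
    HasFDerivAt (fun p : LowerSpace d × UpperSpace m => gradH g p.1 p.2)
      ((hessH g h y).comp (ContinuousLinearMap.fst ℝ _ _) +
        (crossHess g h y).comp (ContinuousLinearMap.snd ℝ _ _)) (h, y) := by
  have h0 := ((hg.contDiffAt_gradH hh hy).differentiableAt one_ne_zero).hasFDerivAt
  have h1 : hessH g h y = _ :=
    (HasFDerivAt.comp (f := fun h' => (h', y)) h h0
      ((hasFDerivAt_id h).prodMk (hasFDerivAt_const y h))).fderiv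
  have h2 : crossHess g h y = _ :=
    (HasFDerivAt.comp (f := fun y' => (h, y')) y h0
      ((hasFDerivAt_const h y).prodMk (hasFDerivAt_id y))).fderiv
  refine h0.congr_fderiv ?_
  rw [h1, h2]
  refine ContinuousLinearMap.ext fun p => ?_
  change fderiv ℝ (fun p : LowerSpace d × UpperSpace m => gradH g p.1 p.2) (h, y) p
    = fderiv ℝ (fun p : LowerSpace d × UpperSpace m => gradH g p.1 p.2) (h, y) (p.1, 0)
      + fderiv ℝ (fun p : LowerSpace d × UpperSpace m => gradH g p.1 p.2) (h, y) (0, p.2)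
  rw [← map_add]
  simp

lemma LowerAssumptions.hasFDerivAt_gradH_left (hg : LowerAssumptions C g Lg Ωg τh ρh Λ τy ρy)
    {h : LowerSpace d} (hh : h ∈ simplices d) {y : UpperSpace m} (hy : y ∈ C) :
    HasFDerivAt (fun h' => gradH g h' y) (hessH g h y) h :=
  (HasFDerivAt.comp (f := fun h' => (h', y)) h (hg.hasFDerivAt_gradH hh hy)
    ((hasFDerivAt_id h).prodMk (hasFDerivAt_const y h))).differentiableAt.hasFDerivAt

lemma LowerAssumptions.hasFDerivAt_gradH_right (hg : LowerAssumptions C g Lg Ωg τh ρh Λ τy ρy)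
    {h : LowerSpace d} (hh : h ∈ simplices d) {y : UpperSpace m} (hy : y ∈ C) :
    HasFDerivAt (fun y' => gradH g h y') (crossHess g h y) y :=
  (HasFDerivAt.comp (f := fun y' => (h, y')) y (hg.hasFDerivAt_gradH hh hy)
    ((hasFDerivAt_const h y).prodMk (hasFDerivAt_id y))).differentiableAt.hasFDerivAt

lemma LowerAssumptions.add_inner_le (hg : LowerAssumptions C g Lg Ωg τh ρh Λ τy ρy)
    {h h' : LowerSpace d} (hh : h ∈ simplices d) (hh' : h' ∈ simplices d) {y : UpperSpace m}
    (hy : y ∈ C) : g h y + inner ℝ (gradH g h y) (h' - h) ≤ g h' y :=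
  add_inner_gradient_le_of_convexOn (hg.convex y hy) hh hh' (hg.differentiableAt hh hy)

lemma LowerAssumptions.inner_gradH_sub_nonneg (hg : LowerAssumptions C g Lg Ωg τh ρh Λ τy ρy)
    {h h' : LowerSpace d} (hh : h ∈ simplices d) (hh' : h' ∈ simplices d) {y : UpperSpace m}
    (hy : y ∈ C) : 0 ≤ inner ℝ (gradH g h' y - gradH g h y) (h' - h) := by
  have h1 := hg.add_inner_le hh hh' hy
  have h2 := hg.add_inner_le hh' hh hy
  rw [← neg_sub h' h, inner_neg_right] at h2
  rw [inner_sub_left]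
  linarith

/-- The Hessian is positive semidefinite on tangent directions at interior points. -/
lemma LowerAssumptions.inner_hessH_nonneg (hg : LowerAssumptions C g Lg Ωg τh ρh Λ τy ρy)
    {h : LowerSpace d} (hh : h ∈ simplices d) (hh0 : ∀ p, 0 < h p) {y : UpperSpace m}
    (hy : y ∈ C) {v : LowerSpace d} (hv : v ∈ tangentSpace d) :
    0 ≤ inner ℝ v (hessH g h y v) := by
  have h1 := (hg.hasFDerivAt_gradH_left hh hy).hasLineDerivAt v
  rw [HasLineDerivAt] at h1
  have h2 := (tendsto_const_nhds (x := v)).inner (𝕜 := ℝ) h1.tendsto_slope_zero_right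
  refine ge_of_tendsto h2 ?_
  filter_upwards [self_mem_nhdsWithin,
    nhdsWithin_le_nhds (eventually_add_smul_mem_simplices hh hh0 hv)] with t ht ht'
  have h3 := hg.inner_gradH_sub_nonneg hh ht' hy
  rw [add_sub_cancel_left, real_inner_smul_right, real_inner_comm] at h3
  have ht0 : (0 : ℝ) < t := ht
  rw [zero_add, zero_smul, add_zero, real_inner_smul_right]
  exact mul_nonneg (inv_nonneg.2 ht0.le) (nonneg_of_mul_nonneg_right h3 ht0)

lemma LowerAssumptions.isLowerMin_hStar (hd : ∀ i, 0 < d i)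
    (hg : LowerAssumptions C g Lg Ωg τh ρh Λ τy ρy) {y : UpperSpace m} (hy : y ∈ C) (η : ℝ) :
    IsLowerMin g η y (hStar g η y) :=
  Botec.isLowerMin_hStar hd fun _ hh => hg.differentiableAt hh hy

lemma LowerAssumptions.hStar_mem (hd : ∀ i, 0 < d i)
    (hg : LowerAssumptions C g Lg Ωg τh ρh Λ τy ρy) {y : UpperSpace m} (hy : y ∈ C) {η : ℝ}
    (hη : 0 < η) : hStar g η y ∈ truncSimplices d (nuMin d η Ωg) := by
  have hmin := hg.isLowerMin_hStar hd hy η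
  exact hmin.mem_truncSimplices hd hη (hg.differentiableAt hmin.1 hy)
    (hg.grad_bounded y hy _ hmin.1)

end Lower

/-! ### Differentiability of the lower-level solution -/

/-- The linearization of a system restricted to a subspace `T` has a solution operator when its
matrix is positive definite on `T`. -/
lemma exists_linearized_solution {E₁ E₂ : Type*} [NormedAddCommGroup E₁] [InnerProductSpace ℝ E₁]
    [FiniteDimensional ℝ E₁] [NormedAddCommGroup E₂] [NormedSpace ℝ E₂]
    [FiniteDimensional ℝ E₂] (T : Submodule ℝ E₁) {A : E₁ →L[ℝ] E₁} (B : E₂ →L[ℝ] E₁) {η : ℝ}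
    (hη : 0 < η) (hA : ∀ w ∈ T, η * ‖w‖ ^ 2 ≤ inner ℝ (A w) w) :
    ∃ L : E₂ →L[ℝ] E₁, ∀ u, L u ∈ T ∧ ∀ w ∈ T, inner ℝ (A (L u) + B u) w = 0 := by
  let P : E₁ →ₗ[ℝ] T := T.orthogonalProjectionOnto.toLinearMap
  have hP : ∀ x, ∀ w : T, inner ℝ (P x) w = inner ℝ x (w : E₁) := fun x w =>
    T.inner_orthogonalProjectionOnto_eq_of_mem_right w x
  let AT : T →ₗ[ℝ] T := P ∘ₗ A.toLinearMap ∘ₗ T.subtype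
  have hinj : Function.Injective AT := by
    refine (injective_iff_map_eq_zero AT).2 fun w hw => ?_
    have h1 : inner ℝ (A w) (w : E₁) = 0 := by
      rw [← hP, show P (A w) = AT w from rfl, hw, inner_zero_left]
    have h2 := hA w w.2
    rw [h1] at h2
    have h3 : ‖(w : E₁)‖ ^ 2 = 0 :=
      le_antisymm (nonpos_of_mul_nonpos_right h2 hη) (sq_nonneg _)
    simpa using h3
  let e := LinearEquiv.ofInjectiveEndo AT hinj
  refine ⟨LinearMap.toContinuousLinearMap
    (-(T.subtype ∘ₗ e.symm.toLinearMap ∘ₗ P ∘ₗ B.toLinearMap)), fun u => ?_⟩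
  have hL : LinearMap.toContinuousLinearMap
      (-(T.subtype ∘ₗ e.symm.toLinearMap ∘ₗ P ∘ₗ B.toLinearMap)) u
      = ((-(e.symm (P (B u))) : T) : E₁) := rfl
  rw [hL]
  refine ⟨Submodule.coe_mem _, fun w hw => ?_⟩
  have h1 : AT (e.symm (P (B u))) = P (B u) := e.apply_symm_apply _
  have h2 : AT (-(e.symm (P (B u)))) + P (B u) = 0 := by rw [map_neg, h1, neg_add_cancel]
  have h3 : inner ℝ (AT (-(e.symm (P (B u)))) + P (B u)) (⟨w, hw⟩ : T) = 0 := by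
    rw [h2, inner_zero_left]
  rw [inner_add_left, hP] at h3
  rw [inner_add_left, ← h3]
  congr 1
  exact (hP _ ⟨w, hw⟩).symm

/-- A continuous solution `φ` of a system of equations restricted to a subspace `T` is
differentiable where the linearized system is positive definite on `T`. -/
lemma hasFDerivAt_of_restricted_system {E₁ E₂ : Type*} [NormedAddCommGroup E₁]
    [InnerProductSpace ℝ E₁] [NormedAddCommGroup E₂] [NormedSpace ℝ E₂] (T : Submodule ℝ E₁)
    {F : E₁ × E₂ → E₁} {φ : E₂ → E₁} {y : E₂} {A : E₁ →L[ℝ] E₁} {B L : E₂ →L[ℝ] E₁} {η : ℝ}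
    (hF : HasFDerivAt F (A.comp (ContinuousLinearMap.fst ℝ _ _) +
      B.comp (ContinuousLinearMap.snd ℝ _ _)) (φ y, y))
    (hη : 0 < η) (hA : ∀ w ∈ T, η * ‖w‖ ^ 2 ≤ inner ℝ (A w) w)
    (hL : ∀ u, L u ∈ T ∧ ∀ w ∈ T, inner ℝ (A (L u) + B u) w = 0)
    (hφ : ContinuousAt φ y)
    (hsol : ∀ᶠ y' in 𝓝 y, φ y' - φ y ∈ T ∧ ∀ w ∈ T, inner ℝ (F (φ y', y')) w = 0) :
    HasFDerivAt φ L y := by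
  have hy := (hsol.self_of_nhds).2
  rw [hasFDerivAt_iff_isLittleO, Asymptotics.isLittleO_iff]
  intro c hc
  -- The remainder `w = φ y' - φ y - L (y' - y)` satisfies `η ‖w‖ ≤ ε (‖w‖ + (‖L‖ + 1) ‖y' - y‖)`
  -- with the following `ε`.
  set ε := min (η / 2) (c * (η / 2) / (‖L‖ + 1)) with hε
  have hL1 : 0 < ‖L‖ + 1 := by positivity
  have hε0 : 0 < ε := lt_min (by positivity) (by positivity)
  have h1 := (Asymptotics.isLittleO_iff.1 (hasFDerivAt_iff_isLittleO.1 hF)) hε0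
  have h2 : Tendsto (fun y' => (φ y', y')) (𝓝 y) (𝓝 (φ y, y)) :=
    hφ.prodMk_nhds continuousAt_id
  filter_upwards [h2.eventually h1, hsol] with y' h3 h4
  obtain ⟨hT, hs⟩ := h4
  set w := φ y' - φ y - L (y' - y) with hw
  have hwT : w ∈ T := T.sub_mem hT (hL _).1
  set r := F (φ y', y') - F (φ y, y) - (A (φ y' - φ y) + B (y' - y)) with hr
  have hr' : ‖r‖ ≤ ε * (‖φ y' - φ y‖ + ‖y' - y‖) := by
    refine h3.trans (mul_le_mul_of_nonneg_left ?_ hε0.le)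
    rw [Prod.norm_def]
    exact max_le (le_add_of_nonneg_right (norm_nonneg _)) (le_add_of_nonneg_left (norm_nonneg _))
  have h5 : inner ℝ (A w) w = - inner ℝ r w := by
    have e1 := (hL (y' - y)).2 w hwT
    have e2 := hs w hwT
    have e3 := hy w hwT
    have e4 : A w = -r + F (φ y', y') - F (φ y, y) - (A (L (y' - y)) + B (y' - y)) := by
      rw [hr, hw, map_sub A]
      abel
    rw [e4, inner_sub_left, inner_sub_left, inner_add_left, inner_neg_left, e1, e2, e3]
    ring
  have h6 : ‖φ y' - φ y‖ ≤ ‖w‖ + ‖L‖ * ‖y' - y‖ := by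
    have : φ y' - φ y = w + L (y' - y) := by rw [hw]; abel
    rw [this]
    exact (norm_add_le _ _).trans (add_le_add_right (L.le_opNorm _) _)
  have h7 : η * ‖w‖ ≤ ε * (‖w‖ + (‖L‖ + 1) * ‖y' - y‖) := by
    rcases (norm_nonneg w).eq_or_lt with h0 | h0
    · rw [← h0]
      simp only [mul_zero, zero_add]
      positivity
    · refine le_of_mul_le_mul_right ?_ h0
      calc η * ‖w‖ * ‖w‖ = η * ‖w‖ ^ 2 := by ring
        _ ≤ inner ℝ (A w) w := hA w hwT
        _ ≤ ‖r‖ * ‖w‖ := by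
          rw [h5]
          exact (neg_le_abs _).trans (abs_real_inner_le_norm _ _)
        _ ≤ _ := by
          refine mul_le_mul_of_nonneg_right (hr'.trans ?_) h0.le
          refine mul_le_mul_of_nonneg_left ?_ hε0.le
          linarith
  have h8 : ε * ‖w‖ ≤ η / 2 * ‖w‖ := mul_le_mul_of_nonneg_right (min_le_left _ _) (norm_nonneg _)
  have h9 : ε * ((‖L‖ + 1) * ‖y' - y‖) ≤ c * (η / 2) * ‖y' - y‖ := by
    rw [← mul_assoc]
    refine mul_le_mul_of_nonneg_right ?_ (norm_nonneg _)
    rw [← le_div_iff₀ hL1]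
    exact min_le_right _ _
  have h10 : η / 2 * ‖w‖ ≤ η / 2 * (c * ‖y' - y‖) := by nlinarith
  exact le_of_mul_le_mul_left h10 (by positivity)

lemma hasFDerivAt_logVec {h : LowerSpace d} (hh : ∀ p, 0 < h p) :
    HasFDerivAt logVec (invScaling h) h := by
  refine hasFDerivAt_of_apply fun p => ?_
  refine ((EuclideanSpace.proj p : LowerSpace d →L[ℝ] ℝ).hasFDerivAt.log
    (hh p).ne').congr_fderiv ?_
  rfl

/-- Stability of minimizers with respect to the parameter. -/
lemma norm_sub_le_of_isLowerMin {C : Set (UpperSpace m)} {g : LowerSpace d → UpperSpace m → ℝ}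
    {Lg Ωg τh ρh Λ τy ρy η : ℝ} (hη : 0 < η) (hg : LowerAssumptions C g Lg Ωg τh ρh Λ τy ρy)
    {y y' : UpperSpace m} (hy : y ∈ C) {h h' : LowerSpace d} (hh : IsLowerMin g η y h)
    (hh' : IsLowerMin g η y' h') (hg' : DifferentiableAt ℝ (fun z => g z y') h') :
    η * ‖h' - h‖ ≤ ‖gradH g h' y' - gradH g h' y‖ := by
  have hd := hg.differentiableAt hh.1 hy
  have hv := sub_mem_tangentSpace hh'.1 hh.1
  have e1 := hh'.inner_eq_zero hη hg' hv
  have e2 := hh.inner_eq_zero hη hd hv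
  have e3 := sq_norm_le_inner_logVec (hh'.pos hη hg') (simplices_le_one hh'.1) (hh.pos hη hd)
    (simplices_le_one hh.1)
  have e4 := hg.inner_gradH_sub_nonneg hh.1 hh'.1 hy
  have e5 := (neg_le_abs _).trans (abs_real_inner_le_norm (gradH g h' y' - gradH g h' y) (h' - h))
  simp only [inner_add_left, real_inner_smul_left, inner_sub_left] at e1 e2 e3 e4 e5
  have e6 : η * ‖h' - h‖ ^ 2 ≤ ‖gradH g h' y' - gradH g h' y‖ * ‖h' - h‖ := by nlinarith
  rcases (norm_nonneg (h' - h)).eq_or_lt with h0 | h0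
  · rw [← h0, mul_zero]
    exact norm_nonneg _
  · refine le_of_mul_le_mul_right ?_ h0
    linarith

section Lower

variable {C : Set (UpperSpace m)} {g : LowerSpace d → UpperSpace m → ℝ}
  {Lg Ωg τh ρh Λ τy ρy η : ℝ}

lemma LowerAssumptions.eventually_forall_differentiableAt
    (hg : LowerAssumptions C g Lg Ωg τh ρh Λ τy ρy) {y : UpperSpace m} (hy : y ∈ C) :
    ∀ᶠ y' in 𝓝 y, ∀ h ∈ simplices d, DifferentiableAt ℝ (fun h' => g h' y') h := by
  refine isCompact_simplices.eventually_forall_of_forall_eventually fun h hh => ?_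
  exact (continuous_swap.tendsto (y, h)).eventually (hg.eventually_differentiableAt hh hy)

/-- Around `y` the objective need not be convex, but its minimizers still depend continuously on
the parameter at `y`. -/
lemma LowerAssumptions.continuousAt_hStar (hd : ∀ i, 0 < d i) (hη : 0 < η)
    (hg : LowerAssumptions C g Lg Ωg τh ρh Λ τy ρy) {y : UpperSpace m} (hy : y ∈ C) :
    ContinuousAt (hStar g η) y := by
  refine Metric.continuousAt_iff'.2 fun ε hε => ?_
  have h1 : ∀ᶠ y' in 𝓝 y, ∀ h ∈ simplices d, ‖gradH g h y' - gradH g h y‖ < η * ε := by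
    refine isCompact_simplices.eventually_forall_of_forall_eventually fun h hh => ?_
    have hc : Tendsto (fun p : LowerSpace d × UpperSpace m => gradH g p.1 p.2) (𝓝 (h, y))
        (𝓝 (gradH g h y)) := (hg.contDiffAt_gradH hh hy).continuousAt
    have hs1 : Tendsto (fun z : UpperSpace m × LowerSpace d => (z.2, z.1)) (𝓝 (y, h))
        (𝓝 (h, y)) := (continuous_snd.prodMk continuous_fst).tendsto (y, h)
    have hs2 : Tendsto (fun z : UpperSpace m × LowerSpace d => (z.2, y)) (𝓝 (y, h))
        (𝓝 (h, y)) := (continuous_snd.prodMk continuous_const).tendsto (y, h)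
    have hc1 := hc.comp hs1
    have hc2 := hc.comp hs2
    have hc3 := (hc1.sub hc2).norm
    rw [sub_self, norm_zero] at hc3
    exact hc3.eventually_lt_const (by positivity)
  filter_upwards [h1, hg.eventually_forall_differentiableAt hy] with y' h2 h3
  have hmin := hg.isLowerMin_hStar hd hy η
  have hmin' := Botec.isLowerMin_hStar hd (η := η) h3
  have h4 := norm_sub_le_of_isLowerMin hη hg hy hmin hmin' (h3 _ hmin'.1)
  rw [dist_eq_norm]
  exact lt_of_mul_lt_mul_left (h4.trans_lt (h2 _ hmin'.1)) hη.le

/-- The lower-level solution is differentiable, and its derivative solves the linearized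
stationarity conditions. -/
lemma LowerAssumptions.exists_hasFDerivAt_hStar (hd : ∀ i, 0 < d i) (hη : 0 < η)
    (hg : LowerAssumptions C g Lg Ωg τh ρh Λ τy ρy) {y : UpperSpace m} (hy : y ∈ C) :
    ∃ L : UpperSpace m →L[ℝ] LowerSpace d, HasFDerivAt (hStar g η) L y ∧ ∀ u,
      L u ∈ tangentSpace d ∧ ∀ w ∈ tangentSpace d,
        inner ℝ ((hessH g (hStar g η y) y + η • invScaling (hStar g η y)) (L u)
          + crossHess g (hStar g η y) y u) w = 0 := by
  have hmin := hg.isLowerMin_hStar hd hy η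
  have hpos := hmin.pos hη (hg.differentiableAt hmin.1 hy)
  have hA : ∀ w ∈ tangentSpace d, η * ‖w‖ ^ 2 ≤
      inner ℝ ((hessH g (hStar g η y) y + η • invScaling (hStar g η y)) w) w := by
    intro w hw
    have h1 := hg.inner_hessH_nonneg hmin.1 hpos hy hw
    have h2 := mul_le_mul_of_nonneg_left
      (sq_norm_le_inner_invScaling hpos (simplices_le_one hmin.1) w) hη.le
    rw [real_inner_comm] at h1
    rw [add_apply, inner_add_left, smul_apply, real_inner_smul_left]
    linarith
  obtain ⟨L, hL⟩ := exists_linearized_solution (tangentSpace d)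
    (crossHess g (hStar g η y) y) hη hA
  refine ⟨L, hasFDerivAt_of_restricted_system (tangentSpace d)
    (F := fun p => gradH g p.1 p.2 + η • logVec p.1) ?_ hη hA hL
    (hg.continuousAt_hStar hd hη hy) ?_, hL⟩
  · refine ((hg.hasFDerivAt_gradH hmin.1 hy).add
      ((HasFDerivAt.comp (f := Prod.fst) (hStar g η y, y) (hasFDerivAt_logVec hpos)
        hasFDerivAt_fst).const_smul η)).congr_fderiv
      ?_
    ext <;> simp
  · filter_upwards [hg.eventually_forall_differentiableAt hy] with y' h3
    have hmin' := Botec.isLowerMin_hStar hd (η := η) h3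
    exact ⟨sub_mem_tangentSpace hmin'.1 hmin.1, fun w hw =>
      hmin'.inner_eq_zero hη (h3 _ hmin'.1) hw⟩

lemma LowerAssumptions.hasFDerivAt_hStar (hd : ∀ i, 0 < d i) (hη : 0 < η)
    (hg : LowerAssumptions C g Lg Ωg τh ρh Λ τy ρy) {y : UpperSpace m} (hy : y ∈ C) :
    HasFDerivAt (hStar g η) (fderiv ℝ (hStar g η) y) y := by
  obtain ⟨L, hL, -⟩ := hg.exists_hasFDerivAt_hStar hd hη hy
  exact hL.differentiableAt.hasFDerivAt

lemma LowerAssumptions.fderiv_hStar_mem (hd : ∀ i, 0 < d i) (hη : 0 < η)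
    (hg : LowerAssumptions C g Lg Ωg τh ρh Λ τy ρy) {y : UpperSpace m} (hy : y ∈ C)
    (u : UpperSpace m) : fderiv ℝ (hStar g η) y u ∈ tangentSpace d := by
  obtain ⟨L, hL, h⟩ := hg.exists_hasFDerivAt_hStar hd hη hy
  rw [hL.fderiv]
  exact (h u).1

lemma LowerAssumptions.inner_fderiv_hStar_eq_zero (hd : ∀ i, 0 < d i) (hη : 0 < η)
    (hg : LowerAssumptions C g Lg Ωg τh ρh Λ τy ρy) {y : UpperSpace m} (hy : y ∈ C)
    (u : UpperSpace m) {w : LowerSpace d} (hw : w ∈ tangentSpace d) :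
    inner ℝ (hessH g (hStar g η y) y (fderiv ℝ (hStar g η) y u)
      + η • invScaling (hStar g η y) (fderiv ℝ (hStar g η) y u)
      + crossHess g (hStar g η y) y u) w = 0 := by
  obtain ⟨L, hL, h⟩ := hg.exists_hasFDerivAt_hStar hd hη hy
  rw [hL.fderiv]
  exact (h u).2 w hw

lemma LowerAssumptions.norm_fderiv_hStar_le (hd : ∀ i, 0 < d i) (hη : 0 < η) (hΛ : 0 ≤ Λ)
    (hg : LowerAssumptions C g Lg Ωg τh ρh Λ τy ρy) {y : UpperSpace m} (hy : y ∈ C) :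
    ‖fderiv ℝ (hStar g η) y‖ ≤ Λ / η := by
  have hmin := hg.isLowerMin_hStar hd hy η
  have hpos := hmin.pos hη (hg.differentiableAt hmin.1 hy)
  refine ContinuousLinearMap.opNorm_le_bound _ (by positivity) fun u => ?_
  set v := fderiv ℝ (hStar g η) y u with hv
  have hvT : v ∈ tangentSpace d := hg.fderiv_hStar_mem hd hη hy u
  have h0 := hg.inner_fderiv_hStar_eq_zero hd hη hy u hvT
  have h1 := hg.inner_hessH_nonneg hmin.1 hpos hy hvT
  have h2 := mul_le_mul_of_nonneg_left
    (sq_norm_le_inner_invScaling hpos (simplices_le_one hmin.1) v) hη.le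
  have h3 : ‖crossHess g (hStar g η y) y u‖ ≤ Λ * ‖u‖ :=
    (ContinuousLinearMap.le_opNorm _ _).trans
      (mul_le_mul_of_nonneg_right (hg.cross_bounded y hy _ hmin.1) (norm_nonneg _))
  rw [real_inner_comm] at h1
  rw [← hv, inner_add_left, inner_add_left, real_inner_smul_left] at h0
  have h4 := (neg_le_abs _).trans (abs_real_inner_le_norm (crossHess g (hStar g η y) y u) v)
  have h5 : η * ‖v‖ ^ 2 ≤ Λ * ‖u‖ * ‖v‖ := by
    have := mul_le_mul_of_nonneg_right h3 (norm_nonneg v)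
    linarith
  rw [div_mul_eq_mul_div, le_div_iff₀ hη]
  rcases (norm_nonneg v).eq_or_lt with hv0 | hv0
  · rw [← hv0, zero_mul]
    positivity
  · refine le_of_mul_le_mul_right ?_ hv0
    linarith

end Lower

/-! ### Mirror descent steps -/

/-- The logits of a mirror descent step: `pmdStep g η α h y` is their softmax. -/
noncomputable def stepLogits (g : LowerSpace d → UpperSpace m → ℝ) (η α : ℝ) (h : LowerSpace d)
    (y : UpperSpace m) : LowerSpace d :=
  (1 - η * α) • logVec h - α • gradH g h y

lemma pmdStep_eq_blockSoftmax {g : LowerSpace d → UpperSpace m → ℝ} {η α : ℝ} {h : LowerSpace d}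
    {y : UpperSpace m} (hg : DifferentiableAt ℝ (fun h' => g h' y) h) (hh : ∀ p, 0 < h p) :
    pmdStep g η α h y = blockSoftmax (stepLogits g η α h y) := by
  have key : ∀ p, h p * Real.exp (-α * gradH (gEta g η) h y p)
      = Real.exp (stepLogits g η α h y p) := fun p => by
    have : stepLogits g η α h y p
        = Real.log (h p) + -α * gradH (gEta g η) h y p := by
      rw [gradH_gEta hg hh]
      simp only [stepLogits, PiLp.sub_apply, PiLp.smul_apply, PiLp.add_apply, smul_eq_mul,
        logVec_apply]
      ring
    rw [this, Real.exp_add, Real.exp_log (hh p)]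
  ext p
  simp only [pmdStep, key, blockSoftmax_apply]

lemma inner_logVec_blockSoftmax (x : LowerSpace d) {v : LowerSpace d} (hv : v ∈ tangentSpace d) :
    inner ℝ (logVec (blockSoftmax x)) v = inner ℝ x v := by
  rw [inner_eq_sum, inner_eq_sum, Fintype.sum_sigma, Fintype.sum_sigma]
  refine Finset.sum_congr rfl fun i _ => ?_
  have h1 : ∀ j, logVec (blockSoftmax x) ⟨i, j⟩ * v ⟨i, j⟩ = x ⟨i, j⟩ * v ⟨i, j⟩
      - Real.log (∑ k : Fin (d i), Real.exp (x ⟨i, k⟩)) * v ⟨i, j⟩ := fun j => by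
    rw [logVec_apply, blockSoftmax_apply, Real.log_div (Real.exp_pos _).ne'
      (sum_exp_pos x ⟨i, j⟩).ne', Real.log_exp, sub_mul]
  simp only [h1, Finset.sum_sub_distrib, ← Finset.mul_sum, mem_tangentSpace.1 hv i, mul_zero,
    sub_zero]

lemma negEntropy_eq_add {h h' : LowerSpace d} (hh : ∀ p, 0 < h p) (hh' : ∀ p, 0 < h' p) :
    negEntropy h' = negEntropy h + inner ℝ (logVec h) (h' - h) + klDiv h' h := by
  rw [inner_eq_sum]
  simp only [negEntropy, klDiv, ← Finset.sum_add_distrib]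
  refine Finset.sum_congr rfl fun p _ => ?_
  rw [Real.log_div (hh' p).ne' (hh p).ne']
  simp only [PiLp.sub_apply, logVec_apply]
  ring

section Lower

variable {C : Set (UpperSpace m)} {g : LowerSpace d → UpperSpace m → ℝ}
  {Lg Ωg τh ρh Λ τy ρy η α : ℝ}

/-- Mirror descent steps keep the entries above the level `nuMin d η Ωg`. -/
lemma LowerAssumptions.pmdStep_mem (hN : 0 < N) (hd : ∀ i, 0 < d i) (hη : 0 < η) (hα : 0 ≤ α)
    (hηα : η * α ≤ 1) (hg : LowerAssumptions C g Lg Ωg τh ρh Λ τy ρy) {y : UpperSpace m}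
    (hy : y ∈ C) {h : LowerSpace d} (hh : h ∈ truncSimplices d (nuMin d η Ωg)) :
    pmdStep g η α h y ∈ truncSimplices d (nuMin d η Ωg) := by
  have hν := nuMin_pos hN hd η Ωg
  have hpos : ∀ p, 0 < h p := fun p => hν.trans_le (hh.1 p)
  have hs := truncSimplices_subset hν.le hh
  rw [pmdStep_eq_blockSoftmax (hg.differentiableAt hs hy) hpos]
  refine ⟨fun p => ?_, (blockSoftmax_mem_simplices hd _).2⟩
  have hdp : (0 : ℝ) < d p.1 := by exact_mod_cast hd p.1
  set x := stepLogits g η α h y with hx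
  have hxa : ∀ q, x q = (1 - η * α) * Real.log (h q) - α * gradH g h y q := fun q => rfl
  have hG : ∀ q, |gradH g h y q| ≤ Ωg := fun q =>
    (abs_apply_le_norm _ q).trans (hg.grad_bounded y hy h hs)
  have hlogν : η * Real.log (nuMin d η Ωg) ≤ -(2 * Ωg) - η * Real.log (d p.1) := by
    have h1 := Real.log_le_log hν (nuMin_le hd η Ωg p.1)
    rw [Real.log_div (Real.exp_pos _).ne' hdp.ne', Real.log_exp] at h1
    have h2 := mul_le_mul_of_nonneg_left h1 hη.le
    rwa [mul_sub, mul_div_cancel₀ _ hη.ne'] at h2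
  -- The weights `h_j ^ (1 - η α) * d ^ (-η α)` sum to at most one, by the weighted AM-GM
  -- inequality.
  have hamgm : ∑ j : Fin (d p.1), Real.exp ((1 - η * α) * Real.log (h ⟨p.1, j⟩)
      - η * α * Real.log (d p.1)) ≤ 1 := by
    calc _ ≤ ∑ j : Fin (d p.1), ((1 - η * α) * h ⟨p.1, j⟩ + η * α * (d p.1 : ℝ)⁻¹) := by
          refine Finset.sum_le_sum fun j _ => ?_
          have := convexOn_exp.2 (Set.mem_univ (Real.log (h ⟨p.1, j⟩)))
            (Set.mem_univ (-Real.log (d p.1))) (sub_nonneg.2 hηα) (by positivity : 0 ≤ η * α)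
            (by ring)
          simp only [smul_eq_mul, Real.exp_neg, Real.exp_log hdp, Real.exp_log (hpos _),
            mul_neg] at this
          exact this
      _ = 1 := by
          rw [Finset.sum_add_distrib, ← Finset.mul_sum, hh.2 p.1]
          simp only [Finset.sum_const, Finset.card_univ, Fintype.card_fin, nsmul_eq_mul]
          field_simp
          ring
  rw [blockSoftmax_apply, le_div_iff₀ (sum_exp_pos x p), Finset.mul_sum]
  calc ∑ j : Fin (d p.1), nuMin d η Ωg * Real.exp (x ⟨p.1, j⟩)
      ≤ ∑ j : Fin (d p.1), Real.exp (x p) * Real.exp ((1 - η * α) * Real.log (h ⟨p.1, j⟩)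
        - η * α * Real.log (d p.1)) := by
        refine Finset.sum_le_sum fun j _ => ?_
        rw [← Real.exp_add, ← Real.exp_log hν, ← Real.exp_add, Real.exp_le_exp, hxa, hxa]
        have h1 := mul_le_mul_of_nonneg_left (Real.log_le_log hν (hh.1 p)) (sub_nonneg.2 hηα)
        have h2 := mul_le_mul_of_nonneg_left hlogν hα
        have h3 := mul_le_mul_of_nonneg_left (abs_le.1 (hG p)).2 hα
        have h4 := mul_le_mul_of_nonneg_left (abs_le.1 (hG ⟨p.1, j⟩)).1 hα
        linarith
    _ ≤ Real.exp (x p) := by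
        rw [← Finset.mul_sum]
        exact mul_le_of_le_one_right (Real.exp_pos _).le hamgm

/-- Linear convergence of mirror descent in the Kullback-Leibler divergence: the objective is
`η`-strongly convex and `(2 Lg + η)`-smooth relative to the entropy. -/
lemma LowerAssumptions.klDiv_pmdStep_le (hN : 0 < N) (hd : ∀ i, 0 < d i) (hη : 0 < η)
    (hLg : 0 ≤ Lg) (hα : 0 ≤ α) (hαL : α * (2 * Lg + η) ≤ 1)
    (hg : LowerAssumptions C g Lg Ωg τh ρh Λ τy ρy) {y : UpperSpace m}
    (hy : y ∈ C) {h : LowerSpace d} (hh : h ∈ truncSimplices d (nuMin d η Ωg)) :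
    klDiv (hStar g η y) (pmdStep g η α h y) ≤ (1 - η * α) * klDiv (hStar g η y) h := by
  have hν := nuMin_pos hN hd η Ωg
  have hηα : η * α ≤ 1 := by nlinarith [mul_nonneg hα hLg]
  have hmem := hg.pmdStep_mem hN hd hη hα hηα hy hh
  have hmin := hg.isLowerMin_hStar hd hy η
  have hpos : ∀ p, 0 < h p := fun p => hν.trans_le (hh.1 p)
  have hpos' : ∀ p, 0 < pmdStep g η α h y p := fun p => hν.trans_le (hmem.1 p)
  have hs := truncSimplices_subset hν.le hh
  have hs' := truncSimplices_subset hν.le hmem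
  have hposs := hmin.pos hη (hg.differentiableAt hmin.1 hy)
  have e1 := klDiv_three_point hposs hpos' hpos
  have e2 : inner ℝ (logVec (pmdStep g η α h y) - logVec h)
      (hStar g η y - pmdStep g η α h y) = - α * inner ℝ (gradH g h y + η • logVec h)
      (hStar g η y - pmdStep g η α h y) := by
    have hv := sub_mem_tangentSpace hmin.1 hs'
    rw [inner_sub_left, inner_add_left, real_inner_smul_left]
    generalize hStar g η y - pmdStep g η α h y = v at hv ⊢
    rw [pmdStep_eq_blockSoftmax (hg.differentiableAt hs hy) hpos, inner_logVec_blockSoftmax _ hv,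
      stepLogits, inner_sub_left, real_inner_smul_left, real_inner_smul_left]
    ring
  generalize hStar g η y = hs0 at *
  generalize pmdStep g η α h y = h1 at *
  have e3 := hg.add_inner_le hs hmin.1 hy
  have e4 := hg.add_inner_le hs' hs hy
  have e5 := negEntropy_eq_add hpos hposs
  have e6 := negEntropy_eq_add hpos hpos'
  have e7 := hmin.2 h1 hs'
  have e8 := half_sq_norm_le_klDiv hpos' (simplices_le_one hs') hpos (simplices_le_one hs)
  have e9 : inner ℝ (gradH g h1 y - gradH g h y) (h1 - h) ≤ Lg * ‖h1 - h‖ ^ 2 := by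
    refine (real_inner_le_norm _ _).trans ?_
    rw [sq, ← mul_assoc]
    exact mul_le_mul_of_nonneg_right (hg.grad_lipschitz y hy h1 hs' h hs) (norm_nonneg _)
  have e10 : inner ℝ (gradH g h y + η • logVec h) (hs0 - h1)
      = inner ℝ (gradH g h y) (hs0 - h) - inner ℝ (gradH g h y) (h1 - h)
        + η * (inner ℝ (logVec h) (hs0 - h) - inner ℝ (logVec h) (h1 - h)) := by
    rw [← inner_sub_right, ← inner_sub_right, sub_sub_sub_cancel_right, inner_add_left,
      real_inner_smul_left]
  have e11 : inner ℝ (gradH g h1 y) (h - h1) = - inner ℝ (gradH g h1 y) (h1 - h) := by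
    rw [← inner_neg_right, neg_sub]
  rw [inner_sub_left] at e9
  simp only [gEta] at e7
  have e12 : Lg * ‖h1 - h‖ ^ 2 ≤ Lg * (2 * klDiv h1 h) :=
    mul_le_mul_of_nonneg_left (by linarith) hLg
  have e13 : inner ℝ (gradH g h y + η • logVec h) (hs0 - h1)
      ≤ - η * klDiv hs0 h + (2 * Lg + η) * klDiv h1 h := by
    rw [e10]
    have e14 : η * negEntropy hs0 = η * negEntropy h + η * inner ℝ (logVec h) (hs0 - h)
      + η * klDiv hs0 h := by rw [e5]; ring
    have e15 : η * negEntropy h1 = η * negEntropy h + η * inner ℝ (logVec h) (h1 - h)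
      + η * klDiv h1 h := by rw [e6]; ring
    linarith
  have e16 := mul_le_mul_of_nonneg_left e13 hα
  have e17 : 0 ≤ klDiv h1 h := (by positivity : 0 ≤ ‖h1 - h‖ ^ 2 / 2).trans e8
  have e18 := mul_le_mul_of_nonneg_right hαL e17
  rw [e2] at e1
  linarith

lemma LowerAssumptions.hasFDerivAt_pmdStep_left (hg : LowerAssumptions C g Lg Ωg τh ρh Λ τy ρy)
    {y : UpperSpace m} (hy : y ∈ C) {h : LowerSpace d} (hh : h ∈ simplices d)
    (hpos : ∀ p, 0 < h p) :
    HasFDerivAt (fun h' => pmdStep g η α h' y) ((blockCov (pmdStep g η α h y)).comp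
      ((1 - η * α) • invScaling h - α • hessH g h y)) h := by
  have hdiff : ∀ᶠ h' in 𝓝 h, DifferentiableAt ℝ (fun z => g z y) h' := by
    have hc : Tendsto (fun h' : LowerSpace d => (h', y)) (𝓝 h) (𝓝 (h, y)) :=
      (continuous_id.prodMk continuous_const).tendsto h
    exact hc.eventually (hg.eventually_differentiableAt hh hy)
  have hpos' : ∀ᶠ h' : LowerSpace d in 𝓝 h, ∀ p, 0 < h' p := by
    refine eventually_all.2 fun p => ?_
    have hc : ContinuousAt (fun h' : LowerSpace d => h' p) h := by fun_prop
    exact hc.eventually_const_lt (hpos p)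
  have h1 : (fun h' => pmdStep g η α h' y)
      =ᶠ[𝓝 h] fun h' => blockSoftmax (stepLogits g η α h' y) := by
    filter_upwards [hdiff, hpos'] with h' e1 e2 using pmdStep_eq_blockSoftmax e1 e2
  refine HasFDerivAt.congr_of_eventuallyEq ?_ h1
  rw [show pmdStep g η α h y = _ from h1.self_of_nhds]
  exact HasFDerivAt.comp (f := fun h' => stepLogits g η α h' y) h (hasFDerivAt_blockSoftmax _)
    (((hasFDerivAt_logVec hpos).const_smul (1 - η * α)).sub
      ((hg.hasFDerivAt_gradH_left hh hy).const_smul α))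

lemma LowerAssumptions.hasFDerivAt_pmdStep_right (hg : LowerAssumptions C g Lg Ωg τh ρh Λ τy ρy)
    {y : UpperSpace m} (hy : y ∈ C) {h : LowerSpace d} (hh : h ∈ simplices d)
    (hpos : ∀ p, 0 < h p) :
    HasFDerivAt (fun y' => pmdStep g η α h y') ((blockCov (pmdStep g η α h y)).comp
      (-(α • crossHess g h y))) y := by
  have hdiff : ∀ᶠ y' in 𝓝 y, DifferentiableAt ℝ (fun z => g z y') h := by
    have hc : Tendsto (fun y' : UpperSpace m => (h, y')) (𝓝 y) (𝓝 (h, y)) :=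
      (continuous_const.prodMk continuous_id).tendsto y
    exact hc.eventually (hg.eventually_differentiableAt hh hy)
  have h1 : (fun y' => pmdStep g η α h y')
      =ᶠ[𝓝 y] fun y' => blockSoftmax (stepLogits g η α h y') := by
    filter_upwards [hdiff] with y' e1 using pmdStep_eq_blockSoftmax e1 hpos
  refine HasFDerivAt.congr_of_eventuallyEq ?_ h1
  rw [show pmdStep g η α h y = _ from h1.self_of_nhds]
  exact HasFDerivAt.comp (f := fun y' => stepLogits g η α h y') y (hasFDerivAt_blockSoftmax _)
    (((hg.hasFDerivAt_gradH_right hh hy).const_smul α).const_sub _)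

/-- The Jacobian update in closed form. -/
lemma LowerAssumptions.jacStep_apply (hg : LowerAssumptions C g Lg Ωg τh ρh Λ τy ρy)
    {y : UpperSpace m} (hy : y ∈ C) {h : LowerSpace d} (hh : h ∈ simplices d)
    (hpos : ∀ p, 0 < h p) (R : UpperSpace m →L[ℝ] LowerSpace d) (u : UpperSpace m) :
    jacStep g η α R h y u = blockCov (pmdStep g η α h y)
      ((1 - η * α) • invScaling h (R u) - α • hessH g h y (R u) - α • crossHess g h y u) := by
  rw [jacStep, (hg.hasFDerivAt_pmdStep_left hy hh hpos).fderiv,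
    (hg.hasFDerivAt_pmdStep_right hy hh hpos).fderiv, sub_eq_add_neg _ (α • crossHess g h y u),
    map_add]
  rfl

end Lower

/-! ### Convergence of the differentiated iterates -/

/-- A perturbed linear recursion whose perturbations decay at the rate `σ` decays at any slower
rate `r`. -/
lemma le_of_perturbed_recursion {e : ℕ → ℝ} {σ r c U : ℝ} {D : ℕ} (hσ : 0 ≤ σ) (hσr : σ < r)
    (hr : r ≤ 1) (hc : 0 ≤ c) (hU : 0 ≤ U) (he : ∀ t, 0 ≤ e t)
    (hrec : ∀ t < D, e (t + 1) ≤ σ * e t + c * σ ^ t * (e t + U)) {t : ℕ} (ht : t ≤ D) :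
    e t ≤ r ^ t * ((e 0 + U) * Real.exp (c / r / (1 - σ / r))) := by
  have hr0 : 0 < r := hσ.trans_lt hσr
  set θ := σ / r with hθ
  have hθ0 : 0 ≤ θ := by positivity
  have hθ1 : θ < 1 := (div_lt_one hr0).2 hσr
  have hσθ : σ = θ * r := (div_mul_cancel₀ σ hr0.ne').symm
  have key : ∀ t ≤ D, e t + U * r ^ t ≤ r ^ t * ((e 0 + U) *
      Real.exp (c / r * ∑ i ∈ Finset.range t, θ ^ i)) := by
    intro t
    induction t with
    | zero => simp
    | succ t ih =>
      intro ht
      have h1 := ih (Nat.le_of_succ_le ht)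
      have h2 := hrec t ht
      have hθt : 0 ≤ θ ^ t := pow_nonneg hθ0 t
      have hrt : 0 ≤ r ^ t := pow_nonneg hr0.le t
      have hrt1 : r ^ t ≤ 1 := pow_le_one₀ hr0.le hr
      have h3 : e (t + 1) + U * r ^ (t + 1) ≤ r * (1 + c / r * θ ^ t) * (e t + U * r ^ t) := by
        have h4 : r * (1 + c / r * θ ^ t) = r + c * θ ^ t := by field_simp
        rw [h4]
        rw [hσθ, mul_pow] at h2
        have h5 : θ * r * e t ≤ r * e t :=
          mul_le_mul_of_nonneg_right (mul_le_of_le_one_left hr0.le hθ1.le) (he t)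
        have h6 : c * (θ ^ t * r ^ t) * e t ≤ c * θ ^ t * e t := by
          refine mul_le_mul_of_nonneg_right ?_ (he t)
          exact mul_le_mul_of_nonneg_left (mul_le_of_le_one_right hθt hrt1) hc
        rw [pow_succ]
        linarith
      have h7 : 1 + c / r * θ ^ t ≤ Real.exp (c / r * θ ^ t) := by
        rw [add_comm]
        exact Real.add_one_le_exp _
      have h8 : 0 ≤ e t + U * r ^ t := add_nonneg (he t) (by positivity)
      calc e (t + 1) + U * r ^ (t + 1)
          ≤ r * (1 + c / r * θ ^ t) * (e t + U * r ^ t) := h3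
        _ ≤ r * Real.exp (c / r * θ ^ t) * (r ^ t * ((e 0 + U) *
            Real.exp (c / r * ∑ i ∈ Finset.range t, θ ^ i))) :=
          mul_le_mul (mul_le_mul_of_nonneg_left h7 hr0.le) h1 h8 (by positivity)
        _ = _ := by
          rw [Finset.sum_range_succ, mul_add, Real.exp_add, pow_succ]
          ring
  have hgeom : ∑ i ∈ Finset.range t, θ ^ i ≤ 1 / (1 - θ) := by
    rw [one_div, ← tsum_geometric_of_lt_one hθ0 hθ1]
    exact (summable_geometric_of_lt_one hθ0 hθ1).sum_le_tsum _ fun i _ => pow_nonneg hθ0 i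
  have h1 : e t ≤ e t + U * r ^ t := le_add_of_nonneg_right (by positivity)
  refine (h1.trans (key t ht)).trans ?_
  have h2 : c / r * ∑ i ∈ Finset.range t, θ ^ i ≤ c / r / (1 - θ) := by
    rw [div_eq_mul_one_div (c / r) (1 - θ)]
    exact mul_le_mul_of_nonneg_left hgeom (by positivity)
  have h3 := he 0
  gcongr

/-- The Lipschitz constant of `h ↦ blockCov h`, measured in the metric `diag (1 / h⋆)` of a point
`h⋆` of the simplices truncated at level `ν`. -/
noncomputable def covLip (d : Fin N → ℕ) (ν : ℝ) : ℝ :=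
  (√ν)⁻¹ * (√(Fintype.card (Σ i : Fin N, Fin (d i))) * 3)

/-- The size of the perturbation of the Jacobian recursion relative to `σ ^ t`, where
`σ ^ 2 = 1 - η α`. -/
noncomputable def jacPerturb (d : Fin N → ℕ) (ν α Lg τh ρh Λ C₀ : ℝ) : ℝ :=
  √(2 * (Fintype.card (Σ i : Fin N, Fin (d i)) / ν)) *
    ((1 / ν ^ 2 + α * ρh + covLip d ν * (ν⁻¹ + α * Lg)) * (1 + C₀)
      + (α * τh + covLip d ν * (α * Λ)))

/-- A constant `Γ` such that the squared error of the Jacobian after `D` steps is at most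
`Γ * lam η α ^ D`. -/
noncomputable def jacGamma (d : Fin N → ℕ) (ν η α Lg τh ρh Λ C₀ : ℝ) : ℝ :=
  (((√ν)⁻¹ * C₀ + 1) * Real.exp (jacPerturb d ν α Lg τh ρh Λ C₀ / √(lam η α) /
    (1 - √(1 - η * α) / √(lam η α)))) ^ 2

lemma covLip_nonneg (d : Fin N → ℕ) (ν : ℝ) : 0 ≤ covLip d ν := by
  unfold covLip
  positivity

section Lower

variable {C : Set (UpperSpace m)} {g : LowerSpace d → UpperSpace m → ℝ}
  {Lg Ωg τh ρh Λ τy ρy η α C₀ : ℝ}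

/-- The derivative of `h⋆` is a fixed point of the Jacobian update at `h⋆`. -/
lemma LowerAssumptions.fderiv_hStar_eq (hd : ∀ i, 0 < d i) (hη : 0 < η)
    (hg : LowerAssumptions C g Lg Ωg τh ρh Λ τy ρy) {y : UpperSpace m} (hy : y ∈ C)
    (α : ℝ) (u : UpperSpace m) :
    fderiv ℝ (hStar g η) y u = blockCov (hStar g η y)
      ((1 - η * α) • invScaling (hStar g η y) (fderiv ℝ (hStar g η) y u)
        - α • hessH g (hStar g η y) y (fderiv ℝ (hStar g η) y u)
        - α • crossHess g (hStar g η y) y u) := by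
  have hmin := hg.isLowerMin_hStar hd hy η
  have hpos := hmin.pos hη (hg.differentiableAt hmin.1 hy)
  have h1 := blockCov_invScaling hpos (hg.fderiv_hStar_mem hd hη hy u)
  have h2 := blockCov_eq_zero hmin.1
    (fun w hw => hg.inner_fderiv_hStar_eq_zero hd hη hy u hw)
  set v := fderiv ℝ (hStar g η) y u
  rw [map_add, map_add, map_smul, h1] at h2
  rw [map_sub, map_sub, map_smul, map_smul, map_smul, h1]
  have h3 : blockCov (hStar g η y) (hessH g (hStar g η y) y v)
      = -(η • v) - blockCov (hStar g η y) (crossHess g (hStar g η y) y u) := by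
    rw [eq_sub_iff_add_eq, eq_neg_iff_add_eq_zero, ← h2]
    abel
  rw [h3]
  module

/-- One step of the Jacobian recursion contracts the error in the metric `diag (1 / h⋆)`, up to
a perturbation proportional to the distances of the iterates from `h⋆`. -/
lemma LowerAssumptions.norm_invSqrt_jacStep_sub_le (hN : 0 < N) (hd : ∀ i, 0 < d i) (hη : 0 < η)
    (hLg : 0 ≤ Lg) (hα : 0 ≤ α) (hηα : η * α ≤ 1) (hαL : α * (η ^ 2 + Lg ^ 2) ≤ η)
    (hg : LowerAssumptions C g Lg Ωg τh ρh Λ τy ρy) {y : UpperSpace m} (hy : y ∈ C)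
    {h : LowerSpace d} (hh : h ∈ truncSimplices d (nuMin d η Ωg))
    {R : UpperSpace m →L[ℝ] LowerSpace d} {u : UpperSpace m} (hR : R u ∈ tangentSpace d) :
    ‖invSqrt (hStar g η y) (jacStep g η α R h y u - fderiv ℝ (hStar g η) y u)‖
      ≤ √(1 - η * α) * ‖invSqrt (hStar g η y) (R u - fderiv ℝ (hStar g η) y u)‖
        + ‖h - hStar g η y‖ * ((1 / nuMin d η Ωg ^ 2 + α * ρh) * ‖R u‖ + α * τh * ‖u‖)
        + ‖pmdStep g η α h y - hStar g η y‖ * (covLip d (nuMin d η Ωg) *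
          (((nuMin d η Ωg)⁻¹ + α * Lg) * ‖R u‖ + α * Λ * ‖u‖)) := by
  have hν := nuMin_pos hN hd η Ωg
  have hs := truncSimplices_subset hν.le hh
  have hpos : ∀ p, 0 < h p := fun p => hν.trans_le (hh.1 p)
  have hmem := hg.pmdStep_mem hN hd hη hα hηα hy hh
  have hs' := truncSimplices_subset hν.le hmem
  have hst := hg.hStar_mem hd hy hη
  have hsts := truncSimplices_subset hν.le hst
  have hstpos : ∀ p, 0 < hStar g η y p := fun p => hν.trans_le (hst.1 p)
  have hvT := hg.fderiv_hStar_mem hd hη hy u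
  have hfix := hg.fderiv_hStar_eq hd hη hy α u
  have h1s : |1 - η * α| ≤ 1 := by
    rw [abs_of_nonneg (by linarith)]
    linarith [mul_nonneg hη.le hα]
  rw [hg.jacStep_apply hy hs hpos]
  set hb := hStar g η y
  set h' := pmdStep g η α h y
  set v := R u
  set vb := fderiv ℝ (hStar g η) y u
  set ν := nuMin d η Ωg
  set w := (1 - η * α) • invScaling h v - α • hessH g h y v - α • crossHess g h y u
  set w₁ := (1 - η * α) • invScaling hb (v - vb) - α • hessH g hb y (v - vb)
  set w₂ := (1 - η * α) • (invScaling h v - invScaling hb v)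
    - α • (hessH g h y - hessH g hb y) v - α • (crossHess g h y - crossHess g hb y) u
  have hsplit : blockCov h' w - vb
      = blockCov hb w₁ + blockCov hb w₂ + (blockCov h' w - blockCov hb w) := by
    have e1 : w₁ + w₂ = w - ((1 - η * α) • invScaling hb vb - α • hessH g hb y vb
        - α • crossHess g hb y u) := by
      simp only [w₁, w₂, w, map_sub, sub_apply, smul_sub]
      abel
    rw [← map_add, e1, map_sub (blockCov hb) w, ← hfix]
    abel
  have b1 : ‖invSqrt hb (blockCov hb w₁)‖ ≤ √(1 - η * α) * ‖invSqrt hb (v - vb)‖ :=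
    norm_invSqrt_contraction hsts hstpos hα hηα hLg hαL _ (hg.hess_bounded y hy hb hsts)
      (Submodule.sub_mem _ hR hvT)
      (hg.inner_hessH_nonneg hsts hstpos hy (Submodule.sub_mem _ hR hvT))
  have b2 : ‖w₂‖ ≤ ‖h - hb‖ * ((1 / ν ^ 2 + α * ρh) * ‖v‖ + α * τh * ‖u‖) := by
    have c1 : ‖(1 - η * α) • (invScaling h v - invScaling hb v)‖ ≤ ‖h - hb‖ / ν ^ 2 * ‖v‖ := by
      rw [norm_smul, Real.norm_eq_abs]
      exact (mul_le_of_le_one_left (norm_nonneg _) h1s).trans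
        (norm_invScaling_sub_le hν hh.1 hst.1 v)
    have c2 : ‖α • (hessH g h y - hessH g hb y) v‖ ≤ α * (ρh * ‖h - hb‖ * ‖v‖) := by
      rw [norm_smul, Real.norm_eq_abs, abs_of_nonneg hα]
      refine mul_le_mul_of_nonneg_left ((ContinuousLinearMap.le_opNorm _ _).trans ?_) hα
      exact mul_le_mul_of_nonneg_right (hg.hess_lipschitz_h y hy h hs hb hsts) (norm_nonneg _)
    have c3 : ‖α • (crossHess g h y - crossHess g hb y) u‖ ≤ α * (τh * ‖h - hb‖ * ‖u‖) := by
      rw [norm_smul, Real.norm_eq_abs, abs_of_nonneg hα]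
      refine mul_le_mul_of_nonneg_left ((ContinuousLinearMap.le_opNorm _ _).trans ?_) hα
      exact mul_le_mul_of_nonneg_right (hg.cross_lipschitz_h y hy h hs hb hsts) (norm_nonneg _)
    have e := (norm_sub_le _ _).trans (add_le_add ((norm_sub_le _ _).trans (add_le_add c1 c2)) c3)
    refine e.trans_eq ?_
    ring
  have b3 : ‖w‖ ≤ (ν⁻¹ + α * Lg) * ‖v‖ + α * Λ * ‖u‖ := by
    have c1 : ‖(1 - η * α) • invScaling h v‖ ≤ ν⁻¹ * ‖v‖ := by
      rw [norm_smul, Real.norm_eq_abs]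
      exact (mul_le_of_le_one_left (norm_nonneg _) h1s).trans (norm_invScaling_le hν hh.1 v)
    have c2 : ‖α • hessH g h y v‖ ≤ α * (Lg * ‖v‖) := by
      rw [norm_smul, Real.norm_eq_abs, abs_of_nonneg hα]
      refine mul_le_mul_of_nonneg_left ((ContinuousLinearMap.le_opNorm _ _).trans ?_) hα
      exact mul_le_mul_of_nonneg_right (hg.hess_bounded y hy h hs) (norm_nonneg _)
    have c3 : ‖α • crossHess g h y u‖ ≤ α * (Λ * ‖u‖) := by
      rw [norm_smul, Real.norm_eq_abs, abs_of_nonneg hα]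
      refine mul_le_mul_of_nonneg_left ((ContinuousLinearMap.le_opNorm _ _).trans ?_) hα
      exact mul_le_mul_of_nonneg_right (hg.cross_bounded y hy h hs) (norm_nonneg _)
    have e := (norm_sub_le _ _).trans (add_le_add ((norm_sub_le _ _).trans (add_le_add c1 c2)) c3)
    refine e.trans_eq ?_
    ring
  have b4 : ‖invSqrt hb (blockCov h' w - blockCov hb w)‖ ≤ ‖h' - hb‖ * (covLip d ν *
      ((ν⁻¹ + α * Lg) * ‖v‖ + α * Λ * ‖u‖)) := by
    refine (norm_invSqrt_le hν hst.1 _).trans ?_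
    refine (mul_le_mul_of_nonneg_left ((norm_blockCov_sub_le hs' hsts w).trans
      (mul_le_mul_of_nonneg_left b3 (by positivity))) (by positivity)).trans_eq ?_
    unfold covLip
    ring
  rw [hsplit, map_add, map_add]
  refine (norm_add_le _ _).trans (add_le_add ((norm_add_le _ _).trans (add_le_add b1 ?_)) b4)
  exact (norm_invSqrt_blockCov_le hsts hstpos w₂).trans b2

lemma LowerAssumptions.iterate_mem (hN : 0 < N) (hd : ∀ i, 0 < d i) (hη : 0 < η)
    (hα : 0 ≤ α) (hηα : η * α ≤ 1) (hg : LowerAssumptions C g Lg Ωg τh ρh Λ τy ρy)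
    {y : UpperSpace m} (hy : y ∈ C) {h : ℕ → LowerSpace d} {D : ℕ}
    (h0 : h 0 ∈ truncSimplices d (nuMin d η Ωg))
    (hstep : ∀ t < D, h (t + 1) = pmdStep g η α (h t) y) :
    ∀ t ≤ D, h t ∈ truncSimplices d (nuMin d η Ωg) := by
  intro t
  induction t with
  | zero => exact fun _ => h0
  | succ t ih =>
    intro ht
    rw [hstep t ht]
    exact hg.pmdStep_mem hN hd hη hα hηα hy (ih (Nat.le_of_succ_le ht))

lemma LowerAssumptions.klDiv_iterate_le (hN : 0 < N) (hd : ∀ i, 0 < d i) (hη : 0 < η)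
    (hLg : 0 ≤ Lg) (hα : 0 ≤ α) (hαL : α * (2 * Lg + η) ≤ 1)
    (hg : LowerAssumptions C g Lg Ωg τh ρh Λ τy ρy)
    {y : UpperSpace m} (hy : y ∈ C) {h : ℕ → LowerSpace d} {D : ℕ}
    (h0 : h 0 ∈ truncSimplices d (nuMin d η Ωg))
    (hstep : ∀ t < D, h (t + 1) = pmdStep g η α (h t) y) :
    ∀ t ≤ D, klDiv (hStar g η y) (h t) ≤ (1 - η * α) ^ t * klDiv (hStar g η y) (h 0) := by
  have hηα : η * α ≤ 1 := by nlinarith [mul_nonneg hα hLg]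
  intro t
  induction t with
  | zero => simp
  | succ t ih =>
    intro ht
    have hmem := hg.iterate_mem hN hd hη hα hηα hy h0 hstep t (Nat.le_of_succ_le ht)
    rw [hstep t ht, pow_succ']
    refine (hg.klDiv_pmdStep_le hN hd hη hLg hα hαL hy hmem).trans ?_
    rw [mul_assoc]
    exact mul_le_mul_of_nonneg_left (ih (Nat.le_of_succ_le ht)) (by linarith)

/-- Pinsker's inequality for the distance to the lower-level solution. -/
lemma LowerAssumptions.sq_norm_sub_hStar_le (hN : 0 < N) (hd : ∀ i, 0 < d i) (hη : 0 < η)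
    (hg : LowerAssumptions C g Lg Ωg τh ρh Λ τy ρy) {y : UpperSpace m} (hy : y ∈ C)
    {h : LowerSpace d} (hh : h ∈ truncSimplices d (nuMin d η Ωg)) :
    ‖h - hStar g η y‖ ^ 2 ≤ 2 * klDiv (hStar g η y) h := by
  have hν := nuMin_pos hN hd η Ωg
  have hst := hg.hStar_mem hd hy hη
  have := half_sq_norm_le_klDiv (fun p => hν.trans_le (hst.1 p))
    (simplices_le_one (truncSimplices_subset hν.le hst)) (fun p => hν.trans_le (hh.1 p))
    (simplices_le_one (truncSimplices_subset hν.le hh))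
  rw [norm_sub_rev]
  linarith

/-- Iterative differentiation approximates the derivative of `h⋆` at a linear rate. -/
lemma LowerAssumptions.sq_norm_jac_sub_le (hN : 0 < N) (hd : ∀ i, 0 < d i) (hη : 0 < η)
    (hLg : 0 ≤ Lg) (hτh : 0 ≤ τh) (hρh : 0 ≤ ρh) (hΛ : 0 ≤ Λ) (hC₀ : 0 ≤ C₀) (hα : 0 < α)
    (hηα : η * α < 1) (hαL : α * (2 * Lg + η) ≤ 1)
    (hαL' : α * (η ^ 2 + Lg ^ 2) ≤ η) (hg : LowerAssumptions C g Lg Ωg τh ρh Λ τy ρy)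
    {y : UpperSpace m} (hy : y ∈ C) (hbound : ‖fderiv ℝ (hStar g η) y‖ ≤ C₀)
    {h : ℕ → LowerSpace d} {R : ℕ → UpperSpace m →L[ℝ] LowerSpace d} {D : ℕ}
    (h0 : h 0 ∈ truncSimplices d (nuMin d η Ωg)) (hR0 : R 0 = 0)
    (hstep : ∀ t < D, h (t + 1) = pmdStep g η α (h t) y)
    (hRstep : ∀ t < D, R (t + 1) = jacStep g η α (R t) (h t) y) :
    ‖R D - fderiv ℝ (hStar g η) y‖ ^ 2 ≤
      jacGamma d (nuMin d η Ωg) η α Lg τh ρh Λ C₀ * lam η α ^ D := by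
  have hν := nuMin_pos hN hd η Ωg
  have hηα0 : 0 < η * α := mul_pos hη hα
  have hmem := hg.iterate_mem hN hd hη hα.le hηα.le hy h0 hstep
  have hst := hg.hStar_mem hd hy hη
  have hsts := truncSimplices_subset hν.le hst
  have hlam0 : 0 < lam η α := by unfold lam; linarith
  have hlam1 : lam η α ≤ 1 := by unfold lam; linarith
  set σ := √(1 - η * α)
  set r := √(lam η α) with hr
  have hσ0 : 0 ≤ σ := Real.sqrt_nonneg _
  have hσ1 : σ ≤ 1 := Real.sqrt_le_one.2 (by linarith)
  have hσr : σ < r := Real.sqrt_lt_sqrt (by linarith) (by unfold lam; linarith)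
  have hr1 : r ≤ 1 := Real.sqrt_le_one.2 hlam1
  set ν := nuMin d η Ωg
  set n : ℝ := ((Fintype.card (Σ i : Fin N, Fin (d i)) : ℕ) : ℝ)
  have hδ : ∀ t ≤ D, ‖h t - hStar g η y‖ ≤ √(2 * (n / ν)) * σ ^ t := by
    intro t ht
    refine le_of_sq_le_sq ?_ (by positivity)
    rw [mul_pow, Real.sq_sqrt (by positivity), ← pow_mul, mul_comm t, pow_mul,
      Real.sq_sqrt (by linarith)]
    refine (hg.sq_norm_sub_hStar_le hN hd hη hy (hmem t ht)).trans ?_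
    have h1 := hg.klDiv_iterate_le hN hd hη hLg hα.le hαL hy h0 hstep t ht
    have h2 := mul_le_mul_of_nonneg_left (klDiv_le_card_div hν hst h0)
      (pow_nonneg (by linarith : 0 ≤ 1 - η * α) t)
    linarith
  have hRT : ∀ t ≤ D, ∀ u, R t u ∈ tangentSpace d := by
    intro t ht u
    rcases t with _ | t
    · rw [hR0]
      exact Submodule.zero_mem _
    · have hmt := hmem t (Nat.le_of_succ_le ht)
      rw [hRstep t ht, hg.jacStep_apply hy (truncSimplices_subset hν.le hmt)
        (fun p => hν.trans_le (hmt.1 p)), ← hstep t ht]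
      exact blockCov_mem_tangentSpace (truncSimplices_subset hν.le (hmem _ ht)) _
  set G := ((√ν)⁻¹ * C₀ + 1) * Real.exp (jacPerturb d ν α Lg τh ρh Λ C₀ / r / (1 - σ / r))
    with hG
  have hκ := covLip_nonneg d ν
  have hc : 0 ≤ jacPerturb d ν α Lg τh ρh Λ C₀ := by
    unfold jacPerturb
    positivity
  have hmain : ‖R D - fderiv ℝ (hStar g η) y‖ ≤ r ^ D * G := by
    refine ContinuousLinearMap.opNorm_le_bound _ (by positivity) fun u => ?_
    have hu : ‖fderiv ℝ (hStar g η) y u‖ ≤ C₀ * ‖u‖ :=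
      (ContinuousLinearMap.le_opNorm _ _).trans (mul_le_mul_of_nonneg_right hbound (norm_nonneg _))
    have hnorm : ∀ x : LowerSpace d, ‖x‖ ≤ ‖invSqrt (hStar g η y) x‖ :=
      norm_le_norm_invSqrt (fun p => hν.trans_le (hst.1 p)) (simplices_le_one hsts)
    have hrec := le_of_perturbed_recursion
      (e := fun t => ‖invSqrt (hStar g η y) (R t u - fderiv ℝ (hStar g η) y u)‖) (D := D)
      (U := ‖u‖) hσ0 hσr hr1 hc (norm_nonneg _) (fun t => norm_nonneg _) ?_ le_rfl
    · rw [sub_apply]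
      refine (hnorm _).trans (hrec.trans ?_)
      rw [mul_assoc]
      refine mul_le_mul_of_nonneg_left ?_ (by positivity)
      have h1 : ‖invSqrt (hStar g η y) (R 0 u - fderiv ℝ (hStar g η) y u)‖
          ≤ (√ν)⁻¹ * (C₀ * ‖u‖) := by
        refine (norm_invSqrt_le hν hst.1 _).trans
          (mul_le_mul_of_nonneg_left ?_ (by positivity))
        rwa [hR0, zero_apply, zero_sub, norm_neg]
      rw [hG, mul_right_comm]
      refine mul_le_mul_of_nonneg_right ?_ (Real.exp_pos _).le
      linarith
    · intro t ht
      have hs := hg.norm_invSqrt_jacStep_sub_le hN hd hη hLg hα.le hηα.le hαL' hy (hmem t ht.le)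
        (hRT t ht.le u)
      rw [← hRstep t ht, ← hstep t ht] at hs
      refine hs.trans ?_
      set e := ‖invSqrt (hStar g η y) (R t u - fderiv ℝ (hStar g η) y u)‖
      have hv : ‖R t u‖ ≤ e + C₀ * ‖u‖ := by
        have h1 := norm_add_le (R t u - fderiv ℝ (hStar g η) y u) (fderiv ℝ (hStar g η) y u)
        rw [sub_add_cancel] at h1
        linarith [hnorm (R t u - fderiv ℝ (hStar g η) y u)]
      have he : 0 ≤ e := norm_nonneg _
      have hd1 := hδ t ht.le
      have hd2 : ‖h (t + 1) - hStar g η y‖ ≤ √(2 * (n / ν)) * σ ^ t := by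
        refine (hδ (t + 1) ht).trans (mul_le_mul_of_nonneg_left ?_ (Real.sqrt_nonneg _))
        exact pow_le_pow_of_le_one hσ0 hσ1 t.le_succ
      have hv' : ∀ a b : ℝ, 0 ≤ a → 0 ≤ b →
          a * ‖R t u‖ + b * ‖u‖ ≤ (a * (1 + C₀) + b) * (e + ‖u‖) := by
        intro a b ha hb
        have h1 := mul_le_mul_of_nonneg_left hv ha
        have h2 : 0 ≤ a * (‖u‖ + C₀ * e) + b * e := by positivity
        linarith
      have e1 := mul_le_mul hd1 (hv' (1 / ν ^ 2 + α * ρh) (α * τh) (by positivity)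
        (by positivity)) (by positivity) (by positivity)
      have e2 := mul_le_mul hd2 (mul_le_mul_of_nonneg_left (hv' (ν⁻¹ + α * Lg) (α * Λ)
        (by positivity) (by positivity)) hκ) (by positivity) (by positivity)
      have e3 := add_le_add (add_le_add (le_refl (σ * e)) e1) e2
      refine e3.trans_eq ?_
      unfold jacPerturb
      ring
  have h1 := pow_le_pow_left₀ (norm_nonneg _) hmain 2
  refine h1.trans_eq ?_
  rw [mul_pow, ← pow_mul, mul_comm D 2, pow_mul, hr, Real.sq_sqrt hlam0.le, jacGamma, mul_comm]

end Lower

/-! ### The hypergradient and its error -/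

/-- The chain rule for the bilevel objective. -/
lemma hasGradientAt_bilevelObj {f : JointSpace d m → ℝ} {g : LowerSpace d → UpperSpace m → ℝ}
    {η : ℝ} {y : UpperSpace m} {L : UpperSpace m →L[ℝ] LowerSpace d}
    (hf : DifferentiableAt ℝ f (WithLp.toLp 2 (hStar g η y, y)))
    (hL : HasFDerivAt (hStar g η) L y) :
    HasGradientAt (bilevelObj f g η) (hyperGrad f L (hStar g η y) y) y := by
  rw [hasGradientAt_iff_hasFDerivAt]
  have h1 : HasFDerivAt (fun y' => (WithLp.toLp 2 (hStar g η y', y') : JointSpace d m))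
      (((WithLp.prodContinuousLinearEquiv 2 ℝ (LowerSpace d) (UpperSpace m)).symm :
        (LowerSpace d × UpperSpace m) →L[ℝ] JointSpace d m).comp
        (L.prod (ContinuousLinearMap.id ℝ _))) y :=
    HasFDerivAt.comp (f := fun y' => (hStar g η y', y')) y
      (WithLp.prodContinuousLinearEquiv 2 ℝ (LowerSpace d) (UpperSpace m)).symm.hasFDerivAt
      (hL.prodMk (hasFDerivAt_id y))
  refine (HasFDerivAt.comp y hf.hasFDerivAt h1).congr_fderiv ?_
  refine ContinuousLinearMap.ext fun u => ?_
  rw [InnerProductSpace.toDual_apply_apply, hyperGrad, inner_add_left,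
    ContinuousLinearMap.adjoint_inner_left]
  change fderiv ℝ f (WithLp.toLp 2 (hStar g η y, y)) (WithLp.toLp 2 (L u, u)) = _
  rw [← inner_gradient_left, WithLp.prod_inner_apply, add_comm]
  rfl

/-- The error of the hypergradient is controlled by the errors of the lower-level solution and of
its Jacobian. -/
lemma UpperAssumptions.sq_norm_hyperGrad_sub_le {C : Set (UpperSpace m)}
    {f : JointSpace d m → ℝ} {Lf Ωf C₀ : ℝ} (hf : UpperAssumptions C f Lf Ωf)
    {h h' : LowerSpace d} (hh : h ∈ simplices d) (hh' : h' ∈ simplices d) {y : UpperSpace m}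
    (hy : y ∈ C) {R R' : UpperSpace m →L[ℝ] LowerSpace d} (hR' : ‖R'‖ ≤ C₀) :
    ‖hyperGrad f R h y - hyperGrad f R' h' y‖ ^ 2 ≤
      2 * (1 + C₀ ^ 2) * Lf ^ 2 * ‖h - h'‖ ^ 2 + 2 * Ωf ^ 2 * ‖R - R'‖ ^ 2 := by
  have hfst : ∀ q : JointSpace d m, ‖q.fst‖ ≤ ‖q‖ := fun q => by
    refine le_of_sq_le_sq ?_ (norm_nonneg _)
    rw [WithLp.prod_norm_sq_eq_of_L2]
    exact le_add_of_nonneg_right (sq_nonneg _)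
  set a := gradient f (WithLp.toLp 2 (h, y)) with ha
  set a' := gradient f (WithLp.toLp 2 (h', y)) with ha'
  have hsplit : hyperGrad f R h y - hyperGrad f R' h' y
      = ((a - a').snd + ContinuousLinearMap.adjoint R' (a - a').fst)
        + ContinuousLinearMap.adjoint (R - R') a.fst := by
    simp only [hyperGrad, ← ha, ← ha', WithLp.sub_fst, WithLp.sub_snd, map_sub, sub_apply]
    abel
  have h1 : ‖(a - a').snd + ContinuousLinearMap.adjoint R' (a - a').fst‖ ^ 2
      ≤ (1 + C₀ ^ 2) * (Lf ^ 2 * ‖h - h'‖ ^ 2) := by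
    have e1 : ‖ContinuousLinearMap.adjoint R' (a - a').fst‖ ≤ C₀ * ‖(a - a').fst‖ := by
      refine (ContinuousLinearMap.le_opNorm _ _).trans ?_
      rw [LinearIsometryEquiv.norm_map]
      exact mul_le_mul_of_nonneg_right hR' (norm_nonneg _)
    have e2 := pow_le_pow_left₀ (norm_nonneg _) ((norm_add_le _ _).trans
      (add_le_add_right e1 ‖(a - a').snd‖)) 2
    have e3 : ‖a - a'‖ ≤ Lf * ‖h - h'‖ := by
      refine (hf.lipschitz h hh y hy h' hh' y hy).trans_eq ?_
      congr 1
      rw [← WithLp.toLp_sub, Prod.mk_sub_mk, sub_self]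
      refine (sq_eq_sq₀ (norm_nonneg _) (norm_nonneg _)).1 ?_
      rw [WithLp.prod_norm_sq_eq_of_L2]
      simp
    have e4 := pow_le_pow_left₀ (norm_nonneg _) e3 2
    rw [WithLp.prod_norm_sq_eq_of_L2] at e4
    have e5 := mul_le_mul_of_nonneg_left e4 (by positivity : 0 ≤ 1 + C₀ ^ 2)
    rw [mul_pow Lf] at e5
    nlinarith [sq_nonneg (C₀ * ‖(a - a').snd‖ - ‖(a - a').fst‖)]
  have h2 : ‖ContinuousLinearMap.adjoint (R - R') a.fst‖ ^ 2 ≤ Ωf ^ 2 * ‖R - R'‖ ^ 2 := by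
    rw [← mul_pow]
    refine pow_le_pow_left₀ (norm_nonneg _) ((ContinuousLinearMap.le_opNorm _ _).trans ?_) 2
    rw [LinearIsometryEquiv.norm_map, mul_comm]
    exact mul_le_mul_of_nonneg_right ((hfst a).trans (hf.bounded h hh y hy)) (norm_nonneg _)
  rw [hsplit]
  have h3 := pow_le_pow_left₀ (norm_nonneg _) (norm_add_le
    ((a - a').snd + ContinuousLinearMap.adjoint R' (a - a').fst)
    (ContinuousLinearMap.adjoint (R - R') a.fst)) 2
  have h4 := sq_nonneg (‖(a - a').snd + ContinuousLinearMap.adjoint R' (a - a').fst‖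
    - ‖ContinuousLinearMap.adjoint (R - R') a.fst‖)
  nlinarith

/-! ### The outer loop -/

/-- The change of the divergence when the target moves from `b` to `a`, for the truncated
simplices. -/
lemma klDiv_le_of_target_moves {a b c : LowerSpace d} {ν γ : ℝ} (hν : 0 < ν) (hγ : 0 < γ)
    (ha : a ∈ truncSimplices d ν) (hb : b ∈ truncSimplices d ν) (hc : c ∈ truncSimplices d ν) :
    klDiv a c ≤ (1 + γ / 2) * klDiv b c + (1 / (γ * ν ^ 2) + 1 / ν) * ‖a - b‖ ^ 2 := by
  have ha0 : ∀ p, 0 < a p := fun p => hν.trans_le (ha.1 p)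
  have hb0 : ∀ p, 0 < b p := fun p => hν.trans_le (hb.1 p)
  have hc0 : ∀ p, 0 < c p := fun p => hν.trans_le (hc.1 p)
  have e1 := klDiv_three_point ha0 hb0 hc0
  have e2 := klDiv_le_sq_norm hν ha0 hb.1
  have e3 := half_sq_norm_le_klDiv hb0 (simplices_le_one (truncSimplices_subset hν.le hb)) hc0
    (simplices_le_one (truncSimplices_subset hν.le hc))
  have e4 : inner ℝ (logVec b - logVec c) (a - b) ≤ ν⁻¹ * ‖b - c‖ * ‖a - b‖ :=
    (real_inner_le_norm _ _).trans (mul_le_mul_of_nonneg_right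
      (norm_logVec_sub_le hν hb.1 hc.1) (norm_nonneg _))
  -- Young's inequality
  have e5 : ν⁻¹ * ‖b - c‖ * ‖a - b‖ ≤ γ / 4 * ‖b - c‖ ^ 2 + 1 / (γ * ν ^ 2) * ‖a - b‖ ^ 2 := by
    have h1 : γ / 4 * ‖b - c‖ ^ 2 + 1 / (γ * ν ^ 2) * ‖a - b‖ ^ 2 - ν⁻¹ * ‖b - c‖ * ‖a - b‖
        = γ * (‖b - c‖ / 2 - ‖a - b‖ / (γ * ν)) ^ 2 := by
      field_simp
      ring
    have h2 : 0 ≤ γ * (‖b - c‖ / 2 - ‖a - b‖ / (γ * ν)) ^ 2 := by positivity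
    linarith
  have e6 : ‖a - b‖ ^ 2 / ν = 1 / ν * ‖a - b‖ ^ 2 := by ring
  have e7 := mul_le_mul_of_nonneg_left e3 (by positivity : 0 ≤ γ / 2)
  linarith

/-- A linear recursion with forcing terms, solved in closed form. -/
lemma le_of_forced_recursion {K a : ℕ → ℝ} {q c : ℝ} (hq1 : q ≤ 1)
    (hrec : ∀ k, K (k + 1) ≤ (1 - q) * K k + q * a k + q * c) (hc : 0 ≤ c) (k : ℕ) :
    K k ≤ c + (1 - q) ^ k * K 0
      + q * ∑ l ∈ Finset.range k, (1 - q) ^ (k - 1 - l) * a l := by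
  induction k with
  | zero => simpa using hc
  | succ k ih =>
    have h1 : ∑ l ∈ Finset.range (k + 1), (1 - q) ^ (k + 1 - 1 - l) * a l
        = (1 - q) * ∑ l ∈ Finset.range k, (1 - q) ^ (k - 1 - l) * a l + a k := by
      rw [Finset.sum_range_succ, Nat.add_sub_cancel, Nat.sub_self, pow_zero, one_mul,
        Finset.mul_sum]
      congr 1
      refine Finset.sum_congr rfl fun l hl => ?_
      have : k - l = k - 1 - l + 1 := by
        have := Finset.mem_range.1 hl
        omega
      rw [this, pow_succ]
      ring
    rw [h1, pow_succ]
    have h2 := mul_le_mul_of_nonneg_left ih (sub_nonneg.2 hq1)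
    have h3 := hrec k
    linarith

/-- The residual of a projection lies in the normal cone. -/
lemma smul_sub_mem_normalCone {C : Set (UpperSpace m)} (hC : Convex ℝ C) {u v : UpperSpace m}
    (hv : v ∈ C) (hproj : ∀ w ∈ C, ‖u - v‖ ≤ ‖u - w‖) {c : ℝ} (hc : 0 ≤ c) :
    c • (u - v) ∈ normalCone C v := by
  have h1 : ‖u - v‖ = ⨅ w : C, ‖u - w‖ := by
    have : Nonempty C := ⟨⟨v, hv⟩⟩
    exact le_antisymm (le_ciInf fun w => hproj w w.2)
      (ciInf_le ⟨0, by rintro _ ⟨w, rfl⟩; exact norm_nonneg _⟩ (⟨v, hv⟩ : C))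
  have h2 := (norm_eq_iInf_iff_real_inner_le_zero hC hv).1 h1
  intro w hw
  rw [real_inner_smul_left]
  exact mul_nonpos_of_nonneg_of_nonpos hc (h2 w hw)

lemma exists_isThreshold {η α : ℝ} (hηα0 : 0 < η * α) (hηα : η * α < 1)
    (Lf Ωf C₀ Γ₂ : ℝ) (T₀ : ℕ) : ∃ D₀, IsThreshold η α Lf Ωf C₀ Γ₂ T₀ D₀ := by
  have h1 : Tendsto (fun D : ℕ => (1 - η * α) ^ D) atTop (𝓝 0) :=
    tendsto_pow_atTop_nhds_zero_of_lt_one (by linarith) (by linarith)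
  have h2 : Tendsto (fun D : ℕ => lam η α ^ D) atTop (𝓝 0) :=
    tendsto_pow_atTop_nhds_zero_of_lt_one (by unfold lam; linarith) (by unfold lam; linarith)
  have h3 : Tendsto (fun D => constC2 η α Lf Ωf C₀ Γ₂ D) atTop (𝓝 0) := by
    have := (h1.const_mul (6 * Lf ^ 2 * (1 + C₀ ^ 2))).add (h2.const_mul (3 * Ωf ^ 2 * Γ₂))
    simpa [constC2] using this
  have h4 : Tendsto (fun D => gammaD η α D) atTop (𝓝 1) := by
    simpa [gammaD] using h1.const_sub 1
  have h5 := (h4.eventually_const_le (by norm_num : (4 / 9 : ℝ) < 1)).and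
    (h3.eventually_le_const (by norm_num : (0 : ℝ) < 1 / 2))
  obtain ⟨D₀, hD₀⟩ := eventually_atTop.1 h5
  exact ⟨max T₀ D₀, le_max_left _ _, fun D hD => hD₀ D ((le_max_right _ _).trans hD)⟩

/-- What the bound on the step size `α` is used for. -/
lemma alpha_bounds {η α Lg ν : ℝ} (hη : 0 < η) (hα : 0 < α) (hα' : α ≤ alphaBar η Lg ν) :
    η * α < 1 ∧ α * (2 * Lg + η) ≤ 1 ∧ α * (η ^ 2 + Lg ^ 2) ≤ η := by
  have h1 : α ≤ 1 / (2 * Lg ^ 2 / η + 2 * η) := hα'.trans (min_le_right _ _)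
  rw [le_div_iff₀ (by positivity)] at h1
  have h2 : α * (2 * Lg ^ 2 + 2 * η ^ 2) ≤ η := by
    have h3 := mul_le_mul_of_nonneg_right h1 hη.le
    have h4 : α * (2 * Lg ^ 2 / η + 2 * η) * η = α * (2 * Lg ^ 2 + 2 * η ^ 2) := by
      field_simp
    linarith
  have h5 : 0 ≤ α * Lg ^ 2 := by positivity
  have h6 : 0 < α * η ^ 2 := by positivity
  refine ⟨?_, ?_, by linarith⟩
  · have : η * α * η < 1 * η := by nlinarith
    exact lt_of_mul_lt_mul_right this hη.le
  · have : α * (2 * Lg + η) * η ≤ 1 * η := by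
      nlinarith [mul_nonneg hα.le (sq_nonneg (Lg - η))]
    exact le_of_mul_le_mul_right this hη

lemma jacGamma_pos {d : Fin N → ℕ} {ν η α Lg τh ρh Λ C₀ : ℝ} (hC₀ : 0 ≤ C₀) :
    0 < jacGamma d ν η α Lg τh ρh Λ C₀ := by
  unfold jacGamma
  positivity

section Run

variable {C : Set (UpperSpace m)} {f : JointSpace d m → ℝ} {g : LowerSpace d → UpperSpace m → ℝ}
  {Lf Ωf Lg Ωg τh ρh Λ τy ρy η α C₀ : ℝ} {β : ℕ → ℝ} {D : ℕ} {y : ℕ → UpperSpace m}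
  {h : ℕ → ℕ → LowerSpace d} {R : ℕ → ℕ → UpperSpace m →L[ℝ] LowerSpace d}

lemma IsRun.y_mem_all {ν : ℝ} (hrun : IsRun C f g η ν α β D y h R) (k : ℕ) : y k ∈ C := by
  rcases k with _ | k
  · exact hrun.y_init
  · exact hrun.y_mem k

lemma IsRun.h_zero_mem (hN : 0 < N) (hd : ∀ i, 0 < d i) (hη : 0 < η) (hα : 0 ≤ α)
    (hηα : η * α ≤ 1) (hg : LowerAssumptions C g Lg Ωg τh ρh Λ τy ρy)
    (hrun : IsRun C f g η (nuMin d η Ωg) α β D y h R) (k : ℕ) :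
    h k 0 ∈ truncSimplices d (nuMin d η Ωg) := by
  induction k with
  | zero => exact hrun.h_init
  | succ k ih =>
    rw [hrun.h_warm k]
    exact hg.iterate_mem hN hd hη hα hηα (hrun.y_mem_all k) ih (hrun.h_step k) D le_rfl

lemma LowerAssumptions.gradient_bilevelObj (hd : ∀ i, 0 < d i) (hη : 0 < η)
    (hg : LowerAssumptions C g Lg Ωg τh ρh Λ τy ρy) (hf : UpperAssumptions C f Lf Ωf)
    {y : UpperSpace m} (hy : y ∈ C) :
    HasGradientAt (bilevelObj f g η) (hyperGrad f (fderiv ℝ (hStar g η) y) (hStar g η y) y) y :=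
  hasGradientAt_bilevelObj
    (hf.differentiableAt _ (hg.isLowerMin_hStar hd hy η).1 y hy) (hg.hasFDerivAt_hStar hd hη hy)

/-- The error of the hypergradient estimate in terms of the divergence at the warm start. -/
lemma IsRun.sq_norm_hyperGrad_sub_le (hN : 0 < N) (hd : ∀ i, 0 < d i) (hη : 0 < η)
    (hLg : 0 ≤ Lg) (hτh : 0 ≤ τh) (hρh : 0 ≤ ρh) (hΛ : 0 ≤ Λ) (hC₀ : 0 ≤ C₀) (hα : 0 < α)
    (hα' : α ≤ alphaBar η Lg (nuMin d η Ωg)) (hf : UpperAssumptions C f Lf Ωf)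
    (hg : LowerAssumptions C g Lg Ωg τh ρh Λ τy ρy)
    (hbound : ∀ y ∈ C, ‖fderiv ℝ (hStar g η) y‖ ≤ C₀)
    (hrun : IsRun C f g η (nuMin d η Ωg) α β D y h R) {Γ₂ : ℝ} (hΓ₂ : 0 ≤ Γ₂) (k : ℕ) :
    ‖hyperGrad f (R k D) (h k D) (y k) - gradient (bilevelObj f g η) (y k)‖ ^ 2 ≤
      constC1 η α Ωf (jacGamma d (nuMin d η Ωg) η α Lg τh ρh Λ C₀) D
        + constC2 η α Lf Ωf C₀ Γ₂ D * klDiv (hStar g η (y k)) (h k 0) := by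
  obtain ⟨hηα, hαL, hαL'⟩ := alpha_bounds hη hα hα'
  have hν := nuMin_pos hN hd η Ωg
  have hy := hrun.y_mem_all k
  have h0 := hrun.h_zero_mem hN hd hη hα.le hηα.le hg k
  have hmem := hg.iterate_mem hN hd hη hα.le hηα.le hy h0 (hrun.h_step k) D le_rfl
  have hmin := hg.isLowerMin_hStar hd hy η
  rw [(hg.gradient_bilevelObj hd hη hf hy).gradient]
  refine (hf.sq_norm_hyperGrad_sub_le (truncSimplices_subset hν.le hmem) hmin.1 hy
    (hbound _ hy)).trans ?_
  have e1 := hg.sq_norm_jac_sub_le hN hd hη hLg hτh hρh hΛ hC₀ hα hηα hαL hαL' hy (hbound _ hy)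
    h0 (hrun.R_init k) (hrun.h_step k) (hrun.R_step k)
  have e2 := hg.sq_norm_sub_hStar_le hN hd hη hy hmem
  have e3 := hg.klDiv_iterate_le hN hd hη hLg hα.le hαL hy h0 (hrun.h_step k) D le_rfl
  have hK : 0 ≤ klDiv (hStar g η (y k)) (h k 0) := by
    have := hg.sq_norm_sub_hStar_le hN hd hη hy h0
    linarith [sq_nonneg ‖h k 0 - hStar g η (y k)‖]
  have hlam : 0 ≤ lam η α ^ D := pow_nonneg (by unfold lam; nlinarith) D
  have hs : 0 ≤ (1 - η * α) ^ D := pow_nonneg (by linarith) D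
  have hΓ₁ := (jacGamma_pos (d := d) (ν := nuMin d η Ωg) (η := η) (α := α) (Lg := Lg) (τh := τh)
    (ρh := ρh) (Λ := Λ) hC₀).le
  have e4 : ‖h k D - hStar g η (y k)‖ ^ 2
      ≤ 2 * ((1 - η * α) ^ D * klDiv (hStar g η (y k)) (h k 0)) := by linarith
  have e5 := mul_le_mul_of_nonneg_left e4 (by positivity : 0 ≤ 2 * (1 + C₀ ^ 2) * Lf ^ 2)
  have e6 := mul_le_mul_of_nonneg_left e1 (by positivity : 0 ≤ 2 * Ωf ^ 2)
  have e7 : 0 ≤ 2 * Lf ^ 2 * (1 + C₀ ^ 2) * (1 - η * α) ^ D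
      * klDiv (hStar g η (y k)) (h k 0) := by positivity
  have e8 : 0 ≤ 3 * Ωf ^ 2 * Γ₂ * lam η α ^ D * klDiv (hStar g η (y k)) (h k 0) := by positivity
  have e9 : 0 ≤ Ωf ^ 2 * jacGamma d (nuMin d η Ωg) η α Lg τh ρh Λ C₀ * lam η α ^ D := by
    positivity
  unfold constC1 constC2
  linarith

/-- One outer step contracts the divergence at the warm start, up to the squared length of the
outer step. -/
lemma IsRun.klDiv_succ_le (hN : 0 < N) (hd : ∀ i, 0 < d i) (hη : 0 < η)
    (hLg : 0 ≤ Lg) (hΩg : 0 ≤ Ωg) (hC₀ : 0 < C₀) (hα : 0 < α)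
    (hα' : α ≤ alphaBar η Lg (nuMin d η Ωg)) (hC : Convex ℝ C)
    (hg : LowerAssumptions C g Lg Ωg τh ρh Λ τy ρy)
    (hbound : ∀ y ∈ C, ‖fderiv ℝ (hStar g η) y‖ ≤ C₀)
    (hrun : IsRun C f g η (nuMin d η Ωg) α β D y h R) {k : ℕ} (hβ : 0 < β k)
    (hβ' : β k ≤ nuMin d η Ωg * gammaD η α D / (3 * √2 * C₀)) (hγ : 0 < gammaD η α D)
    {c₁ c₂ : ℝ} (hc₁ : 0 ≤ c₁) (hc₂ : c₂ ≤ 1 / 2) {G z : UpperSpace m}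
    (herr : ‖hyperGrad f (R k D) (h k D) (y k) - G‖ ^ 2
      ≤ c₁ + c₂ * klDiv (hStar g η (y k)) (h k 0))
    (hz : y k - β k • hyperGrad f (R k D) (h k D) (y k) - y (k + 1) = β k • z) :
    klDiv (hStar g η (y (k + 1))) (h (k + 1) 0) ≤
      (1 - gammaD η α D / 4) * klDiv (hStar g η (y k)) (h k 0)
        + gammaD η α D / 4 * ‖G + z‖ ^ 2 + gammaD η α D / 4 * c₁ := by
  obtain ⟨hηα, hαL, -⟩ := alpha_bounds hη hα hα'
  have hν := nuMin_pos hN hd η Ωg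
  have hν1 := nuMin_le_one hN hd hη hΩg
  have hy := hrun.y_mem_all k
  have hy' := hrun.y_mem_all (k + 1)
  have h0 := hrun.h_zero_mem hN hd hη hα.le hηα.le hg k
  have h0' := hrun.h_zero_mem hN hd hη hα.le hηα.le hg (k + 1)
  have hst := hg.hStar_mem hd hy hη
  have hst' := hg.hStar_mem hd hy' hη
  have hK : 0 ≤ klDiv (hStar g η (y k)) (h k 0) := by
    have := hg.sq_norm_sub_hStar_le hN hd hη hy h0
    linarith [sq_nonneg ‖h k 0 - hStar g η (y k)‖]
  have hγ1 : gammaD η α D ≤ 1 := by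
    have := pow_nonneg (by linarith : 0 ≤ 1 - η * α) D
    unfold gammaD
    linarith
  have e1 := klDiv_le_of_target_moves hν hγ hst' hst h0'
  have e2 := hg.klDiv_iterate_le hN hd hη hLg hα.le hαL hy h0 (hrun.h_step k) D le_rfl
  rw [← hrun.h_warm k, show (1 - η * α) ^ D = 1 - gammaD η α D by unfold gammaD; ring] at e2
  have e3 : ‖hStar g η (y (k + 1)) - hStar g η (y k)‖ ≤ C₀ * ‖y (k + 1) - y k‖ :=
    hC.norm_image_sub_le_of_norm_fderiv_le
      (fun x hx => (hg.hasFDerivAt_hStar hd hη hx).differentiableAt) hbound hy hy'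
  set V := hyperGrad f (R k D) (h k D) (y k)
  set ν := nuMin d η Ωg
  set γ := gammaD η α D
  set K := klDiv (hStar g η (y k)) (h k 0)
  have e4 : ‖y (k + 1) - y k‖ = β k * ‖V + z‖ := by
    have : y (k + 1) - y k = -(β k • (V + z)) := by
      rw [smul_add, ← hz]
      abel
    rw [this, norm_neg, norm_smul, Real.norm_eq_abs, abs_of_pos hβ]
  have e5 : C₀ * β k ≤ ν * γ / (3 * √2) := by
    have h1 := mul_le_mul_of_nonneg_left hβ' hC₀.le
    refine h1.trans_eq ?_
    field_simp
  have e6 : ‖hStar g η (y (k + 1)) - hStar g η (y k)‖ ^ 2 ≤ ν ^ 2 * γ ^ 2 / 18 * ‖V + z‖ ^ 2 := by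
    rw [e4, ← mul_assoc] at e3
    have h1 := pow_le_pow_left₀ (norm_nonneg _)
      (e3.trans (mul_le_mul_of_nonneg_right e5 (norm_nonneg _))) 2
    refine h1.trans_eq ?_
    rw [mul_pow, div_pow, mul_pow, mul_pow, Real.sq_sqrt (by norm_num)]
    norm_num
  have e7 : ‖V + z‖ ^ 2 ≤ 2 * (‖G + z‖ ^ 2 + (c₁ + c₂ * K)) := by
    have h1 : V + z = (G + z) + (V - G) := by abel
    have h2 := pow_le_pow_left₀ (norm_nonneg _) (norm_add_le (G + z) (V - G)) 2
    rw [← h1] at h2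
    nlinarith [sq_nonneg (‖G + z‖ - ‖V - G‖)]
  have e8 : (1 / (γ * ν ^ 2) + 1 / ν) * (ν ^ 2 * γ ^ 2 / 18) ≤ γ / 9 := by
    have h1 : (1 / (γ * ν ^ 2) + 1 / ν) * (ν ^ 2 * γ ^ 2 / 18) = γ * (1 + ν * γ) / 18 := by
      field_simp
    have h2 : ν * γ ≤ 1 := mul_le_one₀ hν1 hγ.le hγ1
    rw [h1]
    nlinarith
  have e9 : (1 / (γ * ν ^ 2) + 1 / ν) * ‖hStar g η (y (k + 1)) - hStar g η (y k)‖ ^ 2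
      ≤ γ / 9 * (2 * (‖G + z‖ ^ 2 + (c₁ + c₂ * K))) := by
    refine (mul_le_mul_of_nonneg_left e6 (by positivity)).trans ?_
    rw [← mul_assoc]
    exact mul_le_mul e8 e7 (sq_nonneg _) (by positivity)
  have e10 := mul_le_mul_of_nonneg_left e2 (by positivity : 0 ≤ 1 + γ / 2)
  have e11 : γ * (c₂ * K) ≤ γ * (1 / 2 * K) :=
    mul_le_mul_of_nonneg_left (mul_le_mul_of_nonneg_right hc₂ hK) hγ.le
  have e12 : 0 ≤ γ * ‖G + z‖ ^ 2 := by positivity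
  have e13 : 0 ≤ γ * c₁ := by positivity
  have e14 : 0 ≤ γ * K := by positivity
  have e15 : 0 ≤ γ ^ 2 * K := by positivity
  nlinarith

end Run

end Botec

theorem mainTheorem3 {N m : ℕ} (hN : 0 < N) (d : Fin N → ℕ) (hd : ∀ i, 0 < d i)
    (η α Lg Ωg τh ρh Λ τy ρy C₀ : ℝ) (hη : 0 < η) (hLg : 0 ≤ Lg) (hΩg : 0 ≤ Ωg)
    (hτh : 0 ≤ τh) (hρh : 0 ≤ ρh) (hΛ : 0 ≤ Λ) (hτy : 0 ≤ τy) (hρy : 0 ≤ ρy) (hC₀ : 0 < C₀)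
    (hα : 0 < α) (hα' : α ≤ alphaBar η Lg (nuMin d η Ωg)) :
    ∃ (T₀ : ℕ) (Γ₁ Γ₂ : ℝ), 0 < Γ₁ ∧ 0 < Γ₂ ∧
      ∀ Lf Ωf : ℝ, 0 ≤ Lf → 0 ≤ Ωf →
        (∃ D₀, IsThreshold η α Lf Ωf C₀ Γ₂ T₀ D₀) ∧
        ∀ (C : Set (UpperSpace m)) (f : JointSpace d m → ℝ) (g : LowerSpace d → UpperSpace m → ℝ),
          IsClosed C → Convex ℝ C → UpperAssumptions C f Lf Ωf →
          LowerAssumptions C g Lg Ωg τh ρh Λ τy ρy →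
          (∀ y ∈ C, DifferentiableAt ℝ (hStar g η) y ∧
            DifferentiableAt ℝ (bilevelObj f g η) y ∧
            ‖fderiv ℝ (hStar g η) y‖ ≤ 4 * Λ / (η * Real.sqrt (nuMin d η Ωg))) ∧
          ((∀ y ∈ C, ‖fderiv ℝ (hStar g η) y‖ ≤ C₀) →
            ∀ D₀, IsThreshold η α Lf Ωf C₀ Γ₂ T₀ D₀ → ∀ D, D₀ ≤ D →
            ∀ β : ℕ → ℝ,
              (∀ k, 0 < β k ∧
                β k ≤ nuMin d η Ωg * gammaD η α D / (3 * Real.sqrt 2 * C₀)) →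
            ∀ (y : ℕ → UpperSpace m) (h : ℕ → ℕ → LowerSpace d)
              (R : ℕ → ℕ → UpperSpace m →L[ℝ] LowerSpace d),
              IsRun C f g η (nuMin d η Ωg) α β D y h R →
              ∃ z : ℕ → UpperSpace m,
                (∀ k, z (k + 1) ∈ normalCone C (y (k + 1)) ∧
                  y k - β k • hyperGrad f (R k D) (h k D) (y k) - y (k + 1)
                    = β k • z (k + 1)) ∧
                ∀ k,
                  ‖hyperGrad f (R k D) (h k D) (y k) - gradient (bilevelObj f g η) (y k)‖ ^ 2 ≤
                    constC1 η α Ωf Γ₁ D * (1 + constC2 η α Lf Ωf C₀ Γ₂ D)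
                    + constC2 η α Lf Ωf C₀ Γ₂ D * (1 - gammaD η α D / 4) ^ k
                        * klDiv (hStar g η (y 0)) (h 0 0)
                    + constC2 η α Lf Ωf C₀ Γ₂ D * (gammaD η α D / 4)
                        * ∑ l ∈ Finset.range k, (1 - gammaD η α D / 4) ^ (k - 1 - l)
                            * ‖gradient (bilevelObj f g η) (y l) + z (l + 1)‖ ^ 2) := by
  have hν := nuMin_pos hN hd η Ωg
  obtain ⟨hηα, -, -⟩ := alpha_bounds hη hα hα'
  have hηα0 : 0 < η * α := mul_pos hη hα
  -- The divergence is bounded on the truncated simplices, so the bound on the Jacobian error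
  -- needs no divergence term, and any `Γ₂` will do.
  refine ⟨0, jacGamma d (nuMin d η Ωg) η α Lg τh ρh Λ C₀, 1, jacGamma_pos hC₀.le, one_pos,
    fun Lf Ωf _ _ => ⟨exists_isThreshold hηα0 hηα Lf Ωf C₀ 1 0, ?_⟩⟩
  intro C f g _ hC hf hg
  refine ⟨fun y hy => ⟨(hg.hasFDerivAt_hStar hd hη hy).differentiableAt,
    (hg.gradient_bilevelObj hd hη hf hy).differentiableAt,
    (hg.norm_fderiv_hStar_le hd hη hΛ hy).trans ?_⟩, ?_⟩
  · have h1 : √(nuMin d η Ωg) ≤ 1 := Real.sqrt_le_one.2 (nuMin_le_one hN hd hη hΩg)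
    have h2 : 0 < √(nuMin d η Ωg) := Real.sqrt_pos.2 hν
    rw [div_le_div_iff₀ hη (by positivity)]
    nlinarith [mul_le_mul_of_nonneg_left h1 (mul_nonneg hΛ hη.le), mul_nonneg hΛ hη.le]
  · intro hbound D₀ hD₀ D hD β hβ y h R hrun
    obtain ⟨hγ, hC₂⟩ := hD₀.2 D hD
    have hγ1 : gammaD η α D ≤ 1 := by
      have := pow_nonneg (by linarith : 0 ≤ 1 - η * α) D
      unfold gammaD
      linarith
    have hC₂0 : 0 ≤ constC2 η α Lf Ωf C₀ 1 D := by
      have h1 := pow_nonneg (by linarith : 0 ≤ 1 - η * α) D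
      have h2 : 0 ≤ lam η α ^ D := pow_nonneg (by unfold lam; linarith) D
      unfold constC2
      positivity
    have hC₁0 : 0 ≤ constC1 η α Ωf (jacGamma d (nuMin d η Ωg) η α Lg τh ρh Λ C₀) D := by
      have h1 := (jacGamma_pos (d := d) (ν := nuMin d η Ωg) (η := η) (α := α) (Lg := Lg)
        (τh := τh) (ρh := ρh) (Λ := Λ) hC₀.le).le
      have h2 : 0 ≤ lam η α ^ D := pow_nonneg (by unfold lam; linarith) D
      unfold constC1
      positivity
    let z : ℕ → UpperSpace m := fun n => (β (n - 1))⁻¹ •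
      (y (n - 1) - β (n - 1) • hyperGrad f (R (n - 1) D) (h (n - 1) D) (y (n - 1)) - y n)
    have hz : ∀ k, y k - β k • hyperGrad f (R k D) (h k D) (y k) - y (k + 1)
        = β k • z (k + 1) := fun k => (smul_inv_smul₀ (hβ k).1.ne' _).symm
    have herr := hrun.sq_norm_hyperGrad_sub_le hN hd hη hLg hτh hρh hΛ hC₀.le hα hα' hf hg
      hbound zero_le_one
    refine ⟨z, fun k => ⟨smul_sub_mem_normalCone hC (hrun.y_mem k) (hrun.y_proj k)
      (inv_nonneg.2 (hβ k).1.le), hz k⟩, fun k => ?_⟩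
    have hrec := le_of_forced_recursion (K := fun k => klDiv (hStar g η (y k)) (h k 0))
      (a := fun l => ‖gradient (bilevelObj f g η) (y l) + z (l + 1)‖ ^ 2)
      (q := gammaD η α D / 4) (by linarith)
      (fun k => hrun.klDiv_succ_le hN hd hη hLg hΩg hC₀ hα hα' hC hg hbound (hβ k).1 (hβ k).2
        (by linarith) hC₁0 hC₂ (herr k) (hz k)) hC₁0 k
    have h1 := mul_le_mul_of_nonneg_left hrec hC₂0
    refine (herr k).trans ?_
    linarith
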